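/- Let $K$ be an arbitrary field and let $n \ge 1$ be an integer. Call a matrix $A \in M_n(K)$ a linear combination of $m$ idempotents if $A = \sum_{i=1}^m c_i P_i$ for some scalars $c_1,\dots,c_m \in K$ and some matrices $P_1,\dots,P_m \in M_n(K)$ with $P_i^2 = P_i$ for all $i$, and let $\ell_n(K)$ denote the least non-negative integer $m$ such that every matrix in $M_n(K)$ is a linear combination of $m$ idempotents. Then every matrix in $M_n(K)$ is a linear combination of three idempotents. More precisely, $\ell_n(K) = 3$ except in the following three cases: (a) if $n = 1$, then $\ell_n(K) = 1$; (b) if $n = 2$ and $|K| > 2$, then $\ell_n(K) = 2$; (c) if $n = 3$ and every polynomial of degree $3$ in $K[X]$ has a root in $K$, then $\ell_n(K) = 2$. -/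

import Mathlib

/-- `A` is a linear combination of `m` idempotents: `A = ∑ i, c i • P i` with scalars `c i` and
idempotent matrices `P i`, for `i = 0, …, m - 1`. -/
def IsLinCombIdempotents {K : Type*} [Field K] {n : ℕ} (m : ℕ)
    (A : Matrix (Fin n) (Fin n) K) : Prop :=
  ∃ (c : Fin m → K) (P : Fin m → Matrix (Fin n) (Fin n) K),
    (∀ i, IsIdempotentElem (P i)) ∧ A = ∑ i, c i • P i

/-- The number `ℓ_n(K)` exists and equals `l`: it is the least `m` such that every `n × n` matrix
over `K` is a linear combination of `m` idempotents. -/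
def IdempotentLengthEq (n : ℕ) (K : Type*) [Field K] (l : ℕ) : Prop :=
  IsLeast {m : ℕ | ∀ A : Matrix (Fin n) (Fin n) K, IsLinCombIdempotents m A} l

/-- Every polynomial of degree `3` over `K` has a root in `K`. -/
def EveryCubicHasRoot (K : Type*) [Field K] : Prop :=
  ∀ p : Polynomial K, p.degree = 3 → ∃ x : K, p.IsRoot x

/-! Upper bound. A nilpotent `N` is odd for some `ℤ/2`-grading of the space. If `E` projects onto
the even part, then `N = E N (1 - E) + (1 - E) N E`, and adding `E` to one summand while subtracting
it from the other turns them, up to sign, into idempotents. Variants of this show that two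
idempotents suffice for anything killed by `X ^ j * (X - τ)` and for scalar plus nilpotent. For
three idempotents, a basis adapted to `f` (`exists_adapted_basis`) and a shear conjugation bring `f`
to a 2 × 2 block form with one nilpotent diagonal block and the other a nonzero scalar `c` plus a
matrix killed by some `X ^ j * (X - τ)`. Subtracting `c` times an idempotent clears the upper right
block and the scalar, and the block triangular rest needs only two idempotents
(`linCombIdem_three_fromBlocks`).

Lower bounds. If `A = a P + b Q`, then `A² - (a + b) A` commutes with `P` and `Q`
(`commute_sq_sub_of_idempotents`). This rules out two idempotents for the companion matrix of a
rootless cubic padded by zeros, and for a diagonal matrix with four generic entries, which exists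
because `K` is infinite when every cubic has a root. Over the field with two elements a 2 × 2 matrix
with `A² = A + 1` does the job.

The exceptional sizes 2 and 3 are handled by explicit decompositions of companion matrices; a 3 × 3
matrix without a cyclic vector satisfies a split quadratic. -/

/-- `x` is a linear combination of `m` idempotents of the `K`-algebra `R`. -/
def LinCombIdem (K : Type*) {R : Type*} [Field K] [Ring R] [Algebra K R] (m : ℕ) (x : R) : Prop :=
  ∃ (c : Fin m → K) (P : Fin m → R), (∀ i, IsIdempotentElem (P i)) ∧ x = ∑ i, c i • P i

/-- `x` is annihilated by a polynomial of the form `X ^ j * (X - τ)`. -/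
def NilpotentUpToEigenvalue (K : Type*) {R : Type*} [Field K] [Ring R] [Algebra K R] (x : R) :
    Prop :=
  ∃ (j : ℕ) (τ : K), x ^ j * (x - algebraMap K R τ) = 0

/-! ### Linear combinations of idempotents in an algebra -/

section Algebra

variable {K R S : Type*} [Field K] [Ring R] [Algebra K R] [Ring S] [Algebra K S]

theorem LinCombIdem.map {m : ℕ} {x : R} (f : R →ₐ[K] S) (h : LinCombIdem K m x) :
    LinCombIdem K m (f x) := by
  obtain ⟨c, P, hP, rfl⟩ := h
  exact ⟨c, fun i => f (P i), fun i => (hP i).map f, by simp⟩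

theorem linCombIdem_algEquiv {m : ℕ} {x : R} (f : R ≃ₐ[K] S) :
    LinCombIdem K m (f x) ↔ LinCombIdem K m x :=
  ⟨fun h => by simpa using h.map f.symm.toAlgHom, fun h => h.map f.toAlgHom⟩

theorem LinCombIdem.add_smul {m : ℕ} {x : R} (h : LinCombIdem K m x) (c : K) {P : R}
    (hP : IsIdempotentElem P) : LinCombIdem K (m + 1) (c • P + x) := by
  obtain ⟨d, Q, hQ, rfl⟩ := h
  refine ⟨Fin.cons c d, Fin.cons P Q, fun i => ?_, by simp [Fin.sum_univ_succ]⟩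
  refine Fin.cases ?_ (fun i => ?_) i
  · simpa using hP
  · simpa using hQ i

theorem linCombIdem_zero : LinCombIdem K 0 (0 : R) :=
  ⟨Fin.elim0, Fin.elim0, fun i => i.elim0, by simp⟩

theorem LinCombIdem.mono {m l : ℕ} {x : R} (h : LinCombIdem K m x) (hml : m ≤ l) :
    LinCombIdem K l x := by
  induction l, hml using Nat.le_induction with
  | base => exact h
  | succ l _ ih => simpa using ih.add_smul 0 IsIdempotentElem.zero

theorem linCombIdem_one_of_smul (a : K) {P : R} (hP : IsIdempotentElem P) :
    LinCombIdem K 1 (a • P) := by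
  simpa using (linCombIdem_zero (K := K) (R := R)).add_smul a hP

theorem linCombIdem_two_of_add (a b : K) {P Q : R} (hP : IsIdempotentElem P)
    (hQ : IsIdempotentElem Q) : LinCombIdem K 2 (a • P + b • Q) :=
  (linCombIdem_one_of_smul b hQ).add_smul a hP

theorem LinCombIdem.exists_of_one {x : R} (h : LinCombIdem K 1 x) :
    ∃ (a : K) (P : R), IsIdempotentElem P ∧ x = a • P := by
  obtain ⟨c, P, hP, rfl⟩ := h
  exact ⟨c 0, P 0, hP 0, by simp⟩

theorem LinCombIdem.exists_of_two {x : R} (h : LinCombIdem K 2 x) :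
    ∃ (a b : K) (P Q : R), IsIdempotentElem P ∧ IsIdempotentElem Q ∧ x = a • P + b • Q := by
  obtain ⟨c, P, hP, rfl⟩ := h
  exact ⟨c 0, c 1, P 0, P 1, hP 0, hP 1, by simp [Fin.sum_univ_two]⟩

theorem linCombIdem_one_algebraMap (a : K) : LinCombIdem K 1 (algebraMap K R a) := by
  rw [Algebra.algebraMap_eq_smul_one]
  exact linCombIdem_one_of_smul a IsIdempotentElem.one

theorem NilpotentUpToEigenvalue.map {x : R} (f : R →ₐ[K] S) (h : NilpotentUpToEigenvalue K x) :
    NilpotentUpToEigenvalue K (f x) := by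
  obtain ⟨j, τ, h⟩ := h
  exact ⟨j, τ, by simpa using congrArg f h⟩

/-- The quadratic polynomial in `a • P + b • Q` that is central in the algebra generated by the
idempotents `P` and `Q`. -/
theorem commute_sq_sub_of_idempotents {a b : K} {P Q A : R} (hP : IsIdempotentElem P)
    (hQ : IsIdempotentElem Q) (hA : A = a • P + b • Q) :
    Commute (A * A - (a + b) • A) P ∧ Commute (A * A - (a + b) • A) Q := by
  have hP' : P * P = P := hP
  have hQ' : Q * Q = Q := hQ
  -- The right-hand side is `-ab (P - Q)²`, and `(P - Q)²` commutes with both idempotents.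
  have key : A * A - (a + b) • A = (a * b) • (P * Q + Q * P - P - Q) := by
    subst hA
    simp only [add_mul, mul_add, smul_mul_smul_comm, hP', hQ', smul_add, smul_sub, add_smul,
      smul_smul, mul_comm b a]
    abel
  rw [key]
  constructor
  · refine Commute.smul_left ?_ _
    simp only [Commute, SemiconjBy, add_mul, sub_mul, mul_add, mul_sub, mul_assoc, hP']
    simp only [← mul_assoc, hP']
    abel
  · refine Commute.smul_left ?_ _
    simp only [Commute, SemiconjBy, add_mul, sub_mul, mul_add, mul_sub, mul_assoc, hQ']
    simp only [← mul_assoc, hQ']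
    abel

end Algebra

/-! ### Odd gradings for nilpotent operators, and sums of two idempotents -/

section Grading

variable {K V : Type*} [Field K] [AddCommGroup V] [Module K V]

theorem exists_disjoint_sup_eq {α : Type*} [Lattice α] [BoundedOrder α] [IsModularLattice α]
    [ComplementedLattice α] {a b c : α} (hab : Disjoint a b) (ha : a ≤ c) (hb : b ≤ c) :
    ∃ a', a ≤ a' ∧ Disjoint a' b ∧ a' ⊔ b = c := by
  obtain ⟨a', haa', h⟩ := hab.exists_isCompl
  refine ⟨a' ⊓ c, le_inf haa' ha, h.disjoint.mono_left inf_le_left, ?_⟩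
  rw [inf_comm, inf_sup_assoc_of_le _ hb, h.sup_eq_top, inf_top_eq]

/-- A `ℤ/2`-grading of `N (S)` for which `N` is odd extends to such a grading of `S`. -/
theorem exists_odd_grading_step (N : Module.End K V) {S I₀ I₁ : Submodule K V}
    (hS : S.map N ≤ S) (hI : Disjoint I₀ I₁) (hsup : I₀ ⊔ I₁ = S.map N)
    (h₀ : I₀ ≤ I₁.comap N) (h₁ : I₁ ≤ I₀.comap N) :
    ∃ X₀ X₁ : Submodule K V, Disjoint X₀ X₁ ∧ X₀ ⊔ X₁ = S ∧ X₀ ≤ X₁.comap N ∧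
      X₁ ≤ X₀.comap N := by
  have hI₀ : I₀ ≤ S := le_trans (hsup ▸ le_sup_left) hS
  have hI₁ : I₁ ≤ S := le_trans (hsup ▸ le_sup_right) hS
  set Y₀ := S ⊓ I₁.comap N with hY₀
  set Y₁ := S ⊓ I₀.comap N with hY₁
  -- Both components of `N s` lie in `N (S)`, so they lift to `S` separately. It remains to shrink
  -- `Y₀` and `Y₁` to disjoint pieces that still contain `I₀` and `I₁`.
  have hY : Y₀ ⊔ Y₁ = S := by
    refine le_antisymm (sup_le inf_le_left inf_le_left) fun s hs => ?_
    have : N s ∈ I₀ ⊔ I₁ := hsup ▸ Submodule.mem_map_of_mem hs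
    obtain ⟨i₀, hi₀, i₁, hi₁, hi⟩ := Submodule.mem_sup.1 this
    have : i₁ ∈ S.map N := hsup ▸ Submodule.mem_sup_right hi₁
    obtain ⟨s₁, hs₁, rfl⟩ := this
    refine Submodule.mem_sup.2 ⟨s₁, ⟨hs₁, hi₁⟩, s - s₁, ⟨sub_mem hs hs₁, ?_⟩, by abel⟩
    simpa [← hi] using hi₀
  have hY₀₁ : Y₀ ⊓ Y₁ ≤ LinearMap.ker N := by
    intro x hx
    exact Submodule.disjoint_def.1 hI _ hx.2.2 hx.1.2
  obtain ⟨X₁, hX₁, hd₁, hs₁⟩ := exists_disjoint_sup_eq (a := I₁) (b := I₀ ⊓ Y₁) (c := Y₁)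
    (hI.symm.mono_right inf_le_left) (le_inf hI₁ h₁) inf_le_right
  have hX₁Y : X₁ ≤ Y₁ := hs₁ ▸ le_sup_left
  obtain ⟨X₀, hX₀, hd₀, hs₀⟩ := exists_disjoint_sup_eq (a := I₀) (b := X₁ ⊓ Y₀) (c := Y₀)
    (by
      rw [disjoint_iff_inf_le] at hd₁ ⊢
      exact le_trans (le_inf (inf_le_right.trans inf_le_left)
        (le_inf inf_le_left (inf_le_right.trans (inf_le_left.trans hX₁Y)))) hd₁)
    (le_inf hI₀ h₀) inf_le_right
  have hX₀Y : X₀ ≤ Y₀ := hs₀ ▸ le_sup_left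
  refine ⟨X₀, X₁, ?_, ?_, ?_, ?_⟩
  · rw [disjoint_iff_inf_le] at hd₀ ⊢
    exact le_trans (le_inf inf_le_left (le_inf inf_le_right (inf_le_left.trans hX₀Y))) hd₀
  · refine le_antisymm (sup_le (hX₀Y.trans inf_le_left) (hX₁Y.trans inf_le_left)) ?_
    have hY₀' : Y₀ ≤ X₀ ⊔ X₁ := hs₀ ▸ sup_le_sup_left inf_le_left _
    have hY₁' : Y₁ ≤ X₀ ⊔ X₁ :=
      hs₁ ▸ sup_le le_sup_right (inf_le_left.trans (hX₀.trans le_sup_left))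
    exact hY ▸ sup_le hY₀' hY₁'
  · exact fun x hx => hX₁ (hX₀Y hx).2
  · exact fun x hx => hX₀ (hX₁Y hx).2

/-- Induction on the nilpotency index on `S`: the index on `N (S)` is one less. -/
theorem exists_odd_grading (N : Module.End K V) (k : ℕ) :
    ∀ S : Submodule K V, S.map N ≤ S → S.map (N ^ k) = ⊥ →
    ∃ X₀ X₁ : Submodule K V, Disjoint X₀ X₁ ∧ X₀ ⊔ X₁ = S ∧ X₀ ≤ X₁.comap N ∧
      X₁ ≤ X₀.comap N := by
  induction k with
  | zero =>
    intro S _ h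
    obtain rfl : S = ⊥ := by simpa [Module.End.one_eq_id] using h
    exact ⟨⊥, ⊥, disjoint_bot_left, by simp, bot_le, bot_le⟩
  | succ k ih =>
    intro S hS h
    obtain ⟨I₀, I₁, hd, hs, h₀, h₁⟩ := ih (S.map N) (Submodule.map_mono hS) (by
      rwa [pow_succ, Module.End.mul_eq_comp, Submodule.map_comp] at h)
    exact exists_odd_grading_step N hS hd hs h₀ h₁

/-- If `N` is nilpotent and `e` is an idempotent with `N e = e N = 0`, then there is an idempotent
`E ≥ e` for which the restriction of `N` is odd. -/
theorem exists_odd_idempotent {N e : Module.End K V} (hN : IsNilpotent N)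
    (he : IsIdempotentElem e) (hNe : N * e = 0) (heN : e * N = 0) :
    ∃ E : Module.End K V, IsIdempotentElem E ∧ E * N + N * E = N ∧ E * e = e ∧ e * E = e := by
  obtain ⟨k, hk⟩ := hN
  have hee : ∀ x, e (e x) = e x := fun x => LinearMap.congr_fun he x
  have hNe' : ∀ x, N (e x) = 0 := fun x => LinearMap.congr_fun hNe x
  have heN' : ∀ x, e (N x) = 0 := fun x => LinearMap.congr_fun heN x
  obtain ⟨X₀, X₁, hd, hs, h₀, h₁⟩ := exists_odd_grading N k (LinearMap.ker e)
    (by rintro _ ⟨x, -, rfl⟩; exact heN' x) (by simp [hk])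
  have hX₀ : ∀ x ∈ X₀, e x = 0 := fun x hx =>
    (show X₀ ≤ LinearMap.ker e from hs ▸ le_sup_left) hx
  have hX₁ : ∀ x ∈ X₁, e x = 0 := fun x hx =>
    (show X₁ ≤ LinearMap.ker e from hs ▸ le_sup_right) hx
  -- Only `ker e` is graded; the range of `e`, on which `N` vanishes, is added to the even part.
  -- This yields `E ≥ e`.
  have hc : IsCompl (X₀ ⊔ LinearMap.range e) X₁ := by
    constructor
    · rw [Submodule.disjoint_def]
      intro x hx hx₁
      obtain ⟨y, hy, _, ⟨z, rfl⟩, rfl⟩ := Submodule.mem_sup.1 hx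
      have := hX₁ _ hx₁
      rw [map_add, hX₀ y hy, hee, zero_add] at this
      rw [this, add_zero] at hx₁ ⊢
      exact Submodule.disjoint_def.1 hd y hy hx₁
    · rw [codisjoint_iff, eq_top_iff]
      intro x _
      have h1 : x - e x ∈ X₀ ⊔ X₁ := by
        rw [hs]
        simp [hee]
      have h2 : e x ∈ LinearMap.range e := ⟨x, rfl⟩
      have : x - e x + e x ∈ (X₀ ⊔ X₁) ⊔ LinearMap.range e := Submodule.add_mem_sup h1 h2
      rw [sub_add_cancel] at this
      rwa [sup_right_comm]
  set E := (X₀ ⊔ LinearMap.range e).projection X₁ hc with hE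
  have hEl : ∀ x ∈ X₀ ⊔ LinearMap.range e, E x = x := fun x hx =>
    Submodule.projection_apply_of_mem_left hc hx
  have hEr : ∀ x ∈ X₁, E x = 0 := fun x hx =>
    (Submodule.projection_apply_eq_zero_iff hc).2 hx
  have ind : ∀ {f g : Module.End K V}, (∀ x ∈ X₀, f x = g x) → (∀ x, f (e x) = g (e x)) →
      (∀ x ∈ X₁, f x = g x) → f = g := by
    intro f g hf₀ hfe hf₁
    ext x
    have hx : x ∈ (X₀ ⊔ LinearMap.range e) ⊔ X₁ := by rw [hc.sup_eq_top]; trivial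
    obtain ⟨y, hy, z, hz, rfl⟩ := Submodule.mem_sup.1 hx
    obtain ⟨y, hy', _, ⟨w, rfl⟩, rfl⟩ := Submodule.mem_sup.1 hy
    simp only [map_add, hf₀ y hy', hfe, hf₁ z hz]
  have hE₀ : ∀ x ∈ X₀, E x = x := fun x hx => hEl x (Submodule.mem_sup_left hx)
  have hEe : ∀ x, E (e x) = e x := fun x => hEl _ (Submodule.mem_sup_right ⟨x, rfl⟩)
  refine ⟨E, ind ?_ ?_ ?_, ind ?_ ?_ ?_, ?_, ind ?_ ?_ ?_⟩
  · intro x hx; simp [hE₀ x hx]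
  · intro x; simp [hEe]
  · intro x hx; simp [hEr x hx]
  · intro x hx; simp [hE₀ x hx, hEr _ (h₀ hx)]
  · intro x; simp [hEe, hNe']
  · intro x hx; simp [hEr x hx, hE₀ _ (h₁ hx)]
  · ext x; simp [hEe]
  · intro x hx; simp [hE₀ x hx]
  · intro x; simp [hEe]
  · intro x hx; simp [hEr x hx, hX₁ x hx]

/-- With `N` odd for the grading given by `E`, both `E + E N (1 - E)` and
`E - e - (1 - E) N E` are idempotent. -/
theorem isIdempotentElem_of_odd {R : Type*} [Ring R] {N e E : R} (hE : IsIdempotentElem E)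
    (he : IsIdempotentElem e) (hNe : N * e = 0)
    (hEe : E * e = e) (heE : e * E = e) :
    IsIdempotentElem (E + E * N * (1 - E)) ∧ IsIdempotentElem (E - e - (1 - E) * N * E) ∧
      IsIdempotentElem (1 - E + (1 - E) * N * E) := by
  have hE' : E * E = E := hE
  have hF : (1 - E) * E = 0 := by rw [sub_mul, one_mul, hE', sub_self]
  have hF' : E * (1 - E) = 0 := by rw [mul_sub, mul_one, hE', sub_self]
  have hFF : (1 - E) * (1 - E) = 1 - E := hE.one_sub
  refine ⟨?_, ?_, ?_⟩
  · have h1 : E * (E * N * (1 - E)) = E * N * (1 - E) := by simp only [← mul_assoc, hE']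
    have h2 : E * N * (1 - E) * E = 0 := by rw [mul_assoc, hF, mul_zero]
    have h3 : E * N * (1 - E) * (E * N * (1 - E)) = 0 := by
      rw [← mul_assoc, ← mul_assoc, h2, zero_mul, zero_mul]
    simp only [IsIdempotentElem, add_mul, mul_add, h1, h2, h3, hE']
    abel
  · have g1 : (E - e) * (E - e) = E - e := by
      have he' : e * e = e := he
      simp only [sub_mul, mul_sub, hE', hEe, heE, he']
      abel
    have g2 : (E - e) * ((1 - E) * N * E) = 0 := by
      have : (E - e) * (1 - E) = 0 := by
        simp only [sub_mul, mul_sub, hE', heE, mul_one]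
        abel
      rw [← mul_assoc, ← mul_assoc, this, zero_mul, zero_mul]
    have g3 : (1 - E) * N * E * (E - e) = (1 - E) * N * E := by
      rw [mul_assoc, mul_sub, hE', hEe, mul_sub, mul_assoc _ N e, hNe, mul_zero, sub_zero]
    have g4 : (1 - E) * N * E * ((1 - E) * N * E) = 0 := by
      rw [mul_assoc ((1 - E) * N), ← mul_assoc E, ← mul_assoc E, hF', zero_mul, zero_mul, mul_zero]
    rw [IsIdempotentElem, sub_mul, mul_sub, g1, g2, mul_sub, g3, g4]
    abel
  · have h1 : (1 - E) * ((1 - E) * N * E) = (1 - E) * N * E := by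
      simp only [← mul_assoc, hFF]
    have h2 : (1 - E) * N * E * (1 - E) = 0 := by rw [mul_assoc, hF', mul_zero]
    have h3 : (1 - E) * N * E * ((1 - E) * N * E) = 0 := by
      rw [← mul_assoc, ← mul_assoc, h2, zero_mul, zero_mul]
    rw [IsIdempotentElem, add_mul, mul_add, mul_add, hFF, h1, h2, h3]
    abel

/-- Oddness forces `E N E = 0`, so only the two off-diagonal corners of `N` survive. -/
theorem odd_part_add {R : Type*} [Ring R] {N E : R} (hE : IsIdempotentElem E)
    (h : E * N + N * E = N) : E * N * (1 - E) + (1 - E) * N * E = N := by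
  have h1 : E * N * E = 0 := by
    have := congrArg (fun x => E * x) h
    simp only [mul_add, ← mul_assoc, (show E * E = E from hE)] at this
    simpa using this
  rw [mul_sub, mul_one, sub_mul (1 : R) E N, sub_mul, h1, one_mul, sub_zero, sub_zero, h]

/-- An endomorphism annihilated by `X ^ j * (X - τ)` is a linear combination of two
idempotents. -/
theorem NilpotentUpToEigenvalue.linCombIdem_two_end {B : Module.End K V}
    (h : NilpotentUpToEigenvalue K B) : LinCombIdem K 2 B := by
  obtain ⟨j, τ, h⟩ := h
  rcases eq_or_ne τ 0 with rfl | hτ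
  · have hB : IsNilpotent B := ⟨j + 1, by simpa [pow_succ] using h⟩
    obtain ⟨E, hE, hEN, -, -⟩ := exists_odd_idempotent hB IsIdempotentElem.zero (by simp) (by simp)
    obtain ⟨h1, h2, -⟩ := isIdempotentElem_of_odd (N := B) hE IsIdempotentElem.zero (by simp)
      (by simp) (by simp)
    have := linCombIdem_two_of_add (1 : K) (-1 : K) h1 h2
    convert this using 1
    nth_rewrite 1 [← odd_part_add hE hEN]
    simp only [one_smul, neg_smul]
    abel
  · have hBτ : B ^ (j + 1) = τ • B ^ j := by
      rw [mul_sub, sub_eq_zero, ← pow_succ] at h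
      rw [h, ← Algebra.commutes, ← Algebra.smul_def]
    have hpow : ∀ i, B ^ (j + i) = τ ^ i • B ^ j := by
      intro i
      induction i with
      | zero => simp
      | succ i ih =>
        rw [← add_assoc, pow_succ, ih, smul_mul_assoc, ← pow_succ, hBτ, smul_smul, pow_succ]
    -- The spectral projection onto the `τ`-eigenspace. Then `B = τ (e + n)` with `n` nilpotent and
    -- `n e = e n = 0`, and `e + n` is the difference of the two idempotents built from `E`.
    set e := (τ ^ j)⁻¹ • B ^ j with he
    have hτj : τ ^ j ≠ 0 := pow_ne_zero _ hτ
    have hee : IsIdempotentElem e := by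
      rw [IsIdempotentElem, he, smul_mul_smul_comm, ← pow_add, hpow, smul_smul]
      congr 1
      field_simp
    have hBe : B * e = τ • e := by
      rw [he, mul_smul_comm, ← pow_succ', hBτ, smul_comm]
    have heB : e * B = τ • e := by
      rw [he, smul_mul_assoc, ← pow_succ, hBτ, smul_comm]
    have hBje : ∀ i, B ^ i * e = τ ^ i • e := by
      intro i
      induction i with
      | zero => simp
      | succ i ih => rw [pow_succ, mul_assoc, hBe, mul_smul_comm, ih, smul_smul, pow_succ, mul_comm]
    set n := τ⁻¹ • B - e with hn
    have hne : n * e = 0 := by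
      rw [hn, sub_mul, smul_mul_assoc, hBe, smul_smul, inv_mul_cancel₀ hτ, one_smul, hee, sub_self]
    have hen : e * n = 0 := by
      rw [hn, mul_sub, mul_smul_comm, heB, smul_smul, inv_mul_cancel₀ hτ, one_smul, hee, sub_self]
    have hnB : n = τ⁻¹ • B * (1 - e) := by
      have h1 : τ⁻¹ • τ • e = e := by rw [smul_smul, inv_mul_cancel₀ hτ, one_smul]
      rw [hn, smul_mul_assoc, mul_sub, mul_one, hBe, smul_sub, h1]
    have hnil : IsNilpotent n := by
      refine ⟨j + 1, ?_⟩
      have hc : Commute (τ⁻¹ • B) (1 - e) := by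
        simp only [Commute, SemiconjBy, mul_sub, sub_mul, mul_one, one_mul, smul_mul_assoc,
          mul_smul_comm, hBe, heB, smul_sub]
      rw [hnB, hc.mul_pow, smul_pow, hee.one_sub.pow_succ_eq, smul_mul_assoc, mul_sub, mul_one,
        hBje, hBτ, he, smul_smul _ _ (B ^ j), pow_succ' τ, mul_assoc,
        mul_inv_cancel₀ hτj, mul_one, sub_self, smul_zero]
    obtain ⟨E, hE, hEN, hEe, heE⟩ := exists_odd_idempotent hnil hee hne hen
    obtain ⟨h1, h2, -⟩ := isIdempotentElem_of_odd hE hee hne hEe heE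
    have := linCombIdem_two_of_add τ (-τ) h1 h2
    convert this using 1
    have hB : B = τ • (e + n) := by rw [hn, add_sub_cancel, smul_smul, mul_inv_cancel₀ hτ, one_smul]
    rw [hB]
    nth_rewrite 1 [← odd_part_add hE hEN]
    rw [neg_smul, ← sub_eq_add_neg, ← smul_sub]
    congr 1
    abel

/-- The sum of a scalar and a nilpotent endomorphism is a linear combination of two
idempotents. -/
theorem linCombIdem_two_algebraMap_add_nilpotent_end (a : K) {N : Module.End K V}
    (hN : IsNilpotent N) : LinCombIdem K 2 (algebraMap K (Module.End K V) a + N) := by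
  rcases eq_or_ne a 0 with rfl | ha
  · obtain ⟨j, hj⟩ := hN
    rw [map_zero, zero_add]
    exact NilpotentUpToEigenvalue.linCombIdem_two_end ⟨j, 0, by simp [hj]⟩
  · obtain ⟨n, rfl⟩ : ∃ n, N = a • n := ⟨a⁻¹ • N, by rw [smul_smul, mul_inv_cancel₀ ha, one_smul]⟩
    have hn : IsNilpotent n := by
      simpa [smul_smul, inv_mul_cancel₀ ha] using hN.smul a⁻¹
    obtain ⟨E, hE, hEN, -, -⟩ := exists_odd_idempotent hn IsIdempotentElem.zero (by simp) (by simp)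
    obtain ⟨h1, -, h2⟩ := isIdempotentElem_of_odd (N := n) hE IsIdempotentElem.zero (by simp)
      (by simp) (by simp)
    have := linCombIdem_two_of_add a a h1 h2
    -- The identity used is `1 + n = (E + E n (1 - E)) + (1 - E + (1 - E) n E)`.
    convert this using 1
    rw [Algebra.algebraMap_eq_smul_one, ← smul_add, ← smul_add]
    congr 1
    nth_rewrite 1 [← odd_part_add hE hEN]
    abel

end Grading

section Matrix

variable {K ι : Type*} [Field K] [Fintype ι] [DecidableEq ι]

theorem NilpotentUpToEigenvalue.linCombIdem_two {B : Matrix ι ι K}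
    (h : NilpotentUpToEigenvalue K B) : LinCombIdem K 2 B :=
  (linCombIdem_algEquiv Matrix.toLinAlgEquiv').1
    (h.map Matrix.toLinAlgEquiv'.toAlgHom).linCombIdem_two_end

theorem linCombIdem_two_algebraMap_add_nilpotent (a : K) {N : Matrix ι ι K}
    (hN : IsNilpotent N) : LinCombIdem K 2 (algebraMap K (Matrix ι ι K) a + N) := by
  refine (linCombIdem_algEquiv Matrix.toLinAlgEquiv').1 ?_
  rw [map_add, AlgEquiv.commutes]
  exact linCombIdem_two_algebraMap_add_nilpotent_end a (hN.map Matrix.toLinAlgEquiv')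

end Matrix

open Matrix in
theorem isNilpotent_fromBlocks_zero {K α β : Type*} [Field K] [Fintype α] [DecidableEq α]
    [Fintype β] [DecidableEq β] {N : Matrix α α K} (hN : IsNilpotent N) (G : Matrix α β K) :
    IsNilpotent (fromBlocks N G (0 : Matrix β α K) (0 : Matrix β β K)) := by
  obtain ⟨k, hk⟩ := hN
  have key : ∀ i, fromBlocks N G (0 : Matrix β α K) (0 : Matrix β β K) ^ (i + 1) =
      fromBlocks (N ^ (i + 1)) (N ^ i * G) 0 0 := by
    intro i
    induction i with
    | zero => simp
    | succ i ih => rw [pow_succ', ih, fromBlocks_multiply]; simp [pow_succ', Matrix.mul_assoc]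
  exact ⟨k + 1, by rw [key, pow_succ, hk]; simp⟩

/-! ### Block triangular matrices -/

section Blocks

open Matrix

variable {K α β : Type*} [Field K] [Fintype α] [DecidableEq α] [Fintype β] [DecidableEq β]

theorem exists_fromBlocks_zero₁₂_pow (A : Matrix α α K) (E : Matrix β α K) (Z : Matrix β β K)
    (k : ℕ) : ∃ F, fromBlocks A 0 E Z ^ k = fromBlocks (A ^ k) 0 F (Z ^ k) := by
  induction k with
  | zero => exact ⟨0, by simp⟩
  | succ k ih =>
    obtain ⟨F, hF⟩ := ih
    exact ⟨F * A + Z ^ k * E, by rw [pow_succ, hF, fromBlocks_multiply]; simp [pow_succ]⟩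

theorem algebraMap_eq_fromBlocks (c : K) : algebraMap K (Matrix (α ⊕ β) (α ⊕ β) K) c =
    fromBlocks (algebraMap K _ c) 0 0 (algebraMap K _ c) := by
  simp only [Algebra.algebraMap_eq_smul_one, ← fromBlocks_one, fromBlocks_smul, smul_zero]

theorem NilpotentUpToEigenvalue.fromBlocks {N : Matrix α α K} {Z : Matrix β β K}
    (hZ : NilpotentUpToEigenvalue K Z) (hN : IsNilpotent N) (E : Matrix β α K) :
    NilpotentUpToEigenvalue K (fromBlocks N 0 E Z) := by
  obtain ⟨k, hk⟩ := hN
  obtain ⟨j, τ, h⟩ := hZ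
  refine ⟨k + j, τ, ?_⟩
  obtain ⟨F, hF⟩ := exists_fromBlocks_zero₁₂_pow N E Z j
  obtain ⟨G, hG⟩ := exists_fromBlocks_zero₁₂_pow N E Z k
  have hc : Commute (Matrix.fromBlocks N 0 E Z ^ k)
      (Matrix.fromBlocks N 0 E Z ^ j * (Matrix.fromBlocks N 0 E Z - algebraMap K _ τ)) :=
    ((Commute.refl _).pow_pow _ _).mul_right
      (((Commute.refl _).pow_left _).sub_right (Algebra.commutes τ _).symm)
  -- The left factor now has zero right block column and the right factor has zero upper block row,
  -- so the product vanishes.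
  rw [pow_add, mul_assoc, hc.eq, hF, hG, algebraMap_eq_fromBlocks, sub_eq_add_neg, fromBlocks_neg,
    fromBlocks_add, fromBlocks_multiply, fromBlocks_multiply, hk]
  simp only [Matrix.mul_zero, Matrix.zero_mul, add_zero, neg_zero, ← sub_eq_add_neg, h,
    fromBlocks_zero]

/-- If `A` has a nilpotent diagonal block and the other diagonal block is the sum of a nonzero
scalar and a matrix annihilated by some `X ^ j * (X - τ)`, then `A` is a linear combination of
three idempotents. -/
theorem linCombIdem_three_fromBlocks {c : K} (hc : c ≠ 0) {A₁ : Matrix α α K} {A₂ : Matrix β β K}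
    (h₁ : IsNilpotent A₁) (h₂ : NilpotentUpToEigenvalue K (A₂ - algebraMap K _ c))
    (X : Matrix α β K) (E : Matrix β α K) :
    LinCombIdem K 3 (fromBlocks A₁ X E A₂) := by
  -- Subtracting `c` times this idempotent removes `X` and shifts `A₂` by `-c`, leaving a block
  -- lower triangular matrix.
  have hP : IsIdempotentElem (fromBlocks (0 : Matrix α α K) (c⁻¹ • X) 0 (1 : Matrix β β K)) := by
    simp [IsIdempotentElem, fromBlocks_multiply]
  convert (h₂.fromBlocks h₁ E).linCombIdem_two.add_smul c hP
  rw [fromBlocks_smul, fromBlocks_add]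
  simp [smul_smul, mul_inv_cancel₀ hc, Algebra.algebraMap_eq_smul_one]

end Blocks

/-! ### Extending independent families to bases -/

section Basis

open Module

variable {K V : Type*} [Field K] [AddCommGroup V] [Module K V]

theorem exists_basis_sum_fin [FiniteDimensional K V] {ι : Type*} {v : ι → V}
    (hv : LinearIndependent K v) :
    ∃ (k : ℕ) (b : Basis (ι ⊕ Fin k) K V), ∀ i, b (Sum.inl i) = v i := by
  classical
  have : Finite (ι ⊕ Basis.sumExtendIndex hv) := Module.Finite.finite_basis (Basis.sumExtend hv)
  have : Finite (Basis.sumExtendIndex hv) := Finite.sum_right ι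
  obtain ⟨k, ⟨e⟩⟩ := Finite.exists_equiv_fin (Basis.sumExtendIndex hv)
  refine ⟨k, (Basis.sumExtend hv).reindex ((Equiv.refl _).sumCongr e), fun i => ?_⟩
  simp [Basis.sumExtend]
  rfl

theorem exists_linearIndependent_apply_of_ne_algebraMap {f : Module.End K V}
    (hf : ∀ a, f ≠ algebraMap K _ a) : ∃ v, LinearIndependent K ![v, f v] := by
  by_contra! h
  obtain ⟨a, ha⟩ := LinearMap.exists_eq_smul_id_of_forall_notLinearIndependent h
  exact hf a (by rw [ha]; rfl)

theorem linearIndependent_sumElim_unit {v w : V} (h : LinearIndependent K ![v, w]) :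
    LinearIndependent K (Sum.elim (fun _ : Unit => v) (fun _ : Unit => w)) := by
  have := h.comp (Sum.elim (fun _ : Unit => 0) (fun _ : Unit => 1)) (by
    rintro (_ | _) (_ | _) <;> simp)
  convert this using 1
  ext (_ | _) <;> simp

end Basis

/-! ### Splitting off a nilpotent summand -/

section NilpotentAdd

open Matrix Module

/-- Every square matrix is the sum of a nilpotent matrix and of a matrix annihilated by some
`X ^ j * (X - τ)`. -/
theorem exists_nilpotent_add {K : Type*} [Field K] (n : ℕ) :
    ∀ (ι : Type) [Fintype ι] [DecidableEq ι], Fintype.card ι = n → ∀ D : Matrix ι ι K,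
      ∃ N Z, D = N + Z ∧ IsNilpotent N ∧ NilpotentUpToEigenvalue K Z := by
  induction n with
  | zero =>
    intro ι _ _ h D
    have := Fintype.card_eq_zero_iff.1 h
    exact ⟨0, 0, Subsingleton.elim _ _, IsNilpotent.zero, ⟨1, 0, by simp⟩⟩
  | succ n ih =>
    intro ι _ _ hι D
    by_cases hD : ∃ a, toLinAlgEquiv' D = algebraMap K _ a
    · obtain ⟨a, ha⟩ := hD
      refine ⟨0, D, by simp, IsNilpotent.zero, ⟨0, a, ?_⟩⟩
      apply toLinAlgEquiv'.injective
      rw [pow_zero, one_mul, map_sub, AlgEquiv.commutes, ha, sub_self, map_zero]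
    · push Not at hD
      obtain ⟨v, hv⟩ := exists_linearIndependent_apply_of_ne_algebraMap hD
      obtain ⟨k, b, hb⟩ := exists_basis_sum_fin (linearIndependent_sumElim_unit hv)
      have hk : Fintype.card (Unit ⊕ Fin k) = n := by
        have h1 := finrank_eq_card_basis b
        rw [finrank_fintype_fun_eq_card, hι] at h1
        simp at h1 ⊢
        omega
      set b' := b.reindex (Equiv.sumAssoc _ _ _) with hb'
      set e := toLinAlgEquiv'.trans (LinearMap.toMatrixAlgEquiv b') with he
      set M := e D with hM
      obtain ⟨N, Z, h1, hN, hZ⟩ := ih (Unit ⊕ Fin k) hk M.toBlocks₂₂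
      -- The first two basis vectors are `v` and `D v`, so the corner entry is zero. The induction
      -- splits the lower right block; the rest of the first row goes to the nilpotent part and the
      -- rest of the first column to the other.
      have h0 : M.toBlocks₁₁ = 0 := by
        ext ⟨⟩ ⟨⟩
        have hv0 : b' (Sum.inl ()) = v := by simpa [hb'] using hb (Sum.inl ())
        have hv1 : b' (Sum.inr (Sum.inl ())) = toLinAlgEquiv' D v := by
          simpa [hb'] using hb (Sum.inr ())
        simp [toBlocks₁₁, hM, he, LinearMap.toMatrixAlgEquiv_apply]
        rw [hv0]
        change b'.repr (toLinAlgEquiv' D v) _ = 0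
        rw [← hv1]
        simp
      have hMN : M = fromBlocks 0 M.toBlocks₁₂ 0 N + fromBlocks 0 0 M.toBlocks₂₁ Z := by
        rw [fromBlocks_add, ← h1]
        nth_rewrite 1 [← fromBlocks_toBlocks M]
        simp [h0]
      have hnil : IsNilpotent (fromBlocks (0 : Matrix Unit Unit K) M.toBlocks₁₂ 0 N) := by
        obtain ⟨k, hk⟩ := hN
        refine ⟨k + 1, ?_⟩
        have key : ∀ i, fromBlocks (0 : Matrix Unit Unit K) M.toBlocks₁₂ 0 N ^ (i + 1) =
            fromBlocks 0 (M.toBlocks₁₂ * N ^ i) 0 (N ^ (i + 1)) := by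
          intro i
          induction i with
          | zero => simp
          | succ i ih =>
            rw [pow_succ, ih, fromBlocks_multiply]; simp [pow_succ, Matrix.mul_assoc]
        rw [key, pow_succ, hk]
        simp
      refine ⟨e.symm (fromBlocks 0 M.toBlocks₁₂ 0 N), e.symm (fromBlocks 0 0 M.toBlocks₂₁ Z), ?_,
        hnil.map e.symm, (hZ.fromBlocks IsNilpotent.zero _).map e.symm.toAlgHom⟩
      rw [← map_add, ← hMN, hM, AlgEquiv.symm_apply_apply]

end NilpotentAdd

/-! ### A basis adapted to an endomorphism -/

section AdaptedBasis

open Module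

variable {K V : Type*} [Field K] [AddCommGroup V] [Module K V]

theorem LinearIndependent.sumElim_of_map {W ι κ : Type*} [AddCommGroup W] [Module K W]
    [Finite ι] [Finite κ] {u : ι → V} {w : κ → V} (p : V →ₗ[K] W)
    (hu : LinearIndependent K u) (hpu : ∀ i, p (u i) = 0)
    (hw : LinearIndependent K (fun j => p (w j))) : LinearIndependent K (Sum.elim u w) := by
  have := Fintype.ofFinite ι
  have := Fintype.ofFinite κ
  rw [Fintype.linearIndependent_iff] at hu hw ⊢
  intro g hg
  simp only [Fintype.sum_sum_type, Sum.elim_inl, Sum.elim_inr] at hg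
  have h1 : ∀ j, g (Sum.inr j) = 0 := by
    refine hw _ ?_
    simpa [hpu] using congrArg p hg
  simp only [h1, zero_smul, Finset.sum_const_zero, add_zero] at hg
  rintro (i | j)
  · exact hu _ hg i
  · exact h1 j

/-- If `f x` is never independent of `x` modulo the kernel of `p`, then either `f` acts on the
quotient as a scalar, or the quotient is a line and `f` maps some `x ∉ ker p` into `ker p`. -/
theorem exists_scalar_or_exists_map_eq_zero {k : ℕ} (f : End K V) (p : V →ₗ[K] (Fin k → K))
    (s : (Fin k → K) →ₗ[K] V) (hps : ∀ u, p (s u) = u)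
    (h : ∀ x, ¬ LinearIndependent K ![p x, p (f x)]) :
    (∃ a : K, ∀ x, p (f x) = a • p x) ∨ (k = 1 ∧ ∃ x, p x ≠ 0 ∧ p (f x) = 0) := by
  by_cases hker : ∀ m, p m = 0 → p (f m) = 0
  · left
    have hg : ∀ u, ¬ LinearIndependent K ![u, (p ∘ₗ f ∘ₗ s) u] := fun u => by
      simpa [hps] using h (s u)
    obtain ⟨a, ha⟩ := LinearMap.exists_eq_smul_id_of_forall_notLinearIndependent hg
    refine ⟨a, fun x => ?_⟩
    have h1 := hker (x - s (p x)) (by simp [hps])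
    have h2 := LinearMap.congr_fun ha (p x)
    simp only [map_sub, sub_eq_zero] at h1
    rw [h1]
    simpa using h2
  · right
    push Not at hker
    obtain ⟨m, hm, hq⟩ := hker
    have hline : ∀ u, u ≠ 0 → ∃ a : K, a • u = p (f m) := by
      intro u hu
      have h1 := h (s u)
      -- Adding `m` leaves the image under `p` equal to `u` and changes `p (f ·)` by `p (f m)`. Both
      -- values of `p (f ·)` are multiples of `u`, hence so is `p (f m)`, and the quotient is a
      -- line.
      have h2 := h (s u + m)
      rw [hps, LinearIndependent.pair_iff' hu] at h1
      rw [map_add, hps, hm, add_zero, LinearIndependent.pair_iff' hu] at h2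
      push Not at h1 h2
      obtain ⟨a, ha⟩ := h1
      obtain ⟨b, hb⟩ := h2
      refine ⟨b - a, ?_⟩
      rw [sub_smul, ha, hb, map_add, map_add]
      abel
    refine ⟨?_, ?_⟩
    · have h1 : finrank K (Fin k → K) = 1 := by
        refine finrank_eq_one (p (f m)) hq fun u => ?_
        rcases eq_or_ne u 0 with rfl | hu
        · exact ⟨0, by simp⟩
        · obtain ⟨a, ha⟩ := hline u hu
          have ha0 : a ≠ 0 := by
            rintro rfl
            exact hq (by rw [← ha, zero_smul])
          exact ⟨a⁻¹, by rw [← ha, smul_smul, inv_mul_cancel₀ ha0, one_smul]⟩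
      simpa using h1
    · have h1 := h (s (p (f m)))
      rw [hps, LinearIndependent.pair_iff' hq] at h1
      push Not at h1
      obtain ⟨a, ha⟩ := h1
      refine ⟨s (p (f m)) - a • m, ?_, ?_⟩
      · simpa [hps, hm] using hq
      · simp [← ha]

theorem exists_maximal_linearIndependent_apply [FiniteDimensional K V] (f : End K V) :
    ∃ (m : ℕ) (l : Fin m → V), LinearIndependent K (Sum.elim l (f ∘ l)) ∧
      ∀ l' : Fin m ⊕ Unit → V, ¬ LinearIndependent K (Sum.elim l' (f ∘ l')) := by
  by_contra! h
  have key : ∀ m : ℕ, ∃ l : Fin m → V, LinearIndependent K (Sum.elim l (f ∘ l)) := by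
    intro m
    induction m with
    | zero => exact ⟨Fin.elim0, linearIndependent_empty_type⟩
    | succ m ih =>
      obtain ⟨l, hl⟩ := ih
      obtain ⟨l', hl'⟩ := h m l hl
      let e : Fin (m + 1) ≃ Fin m ⊕ Unit := Fintype.equivOfCardEq (by simp)
      refine ⟨l' ∘ e, ?_⟩
      have := hl'.comp _ (e.sumCongr e).injective
      convert this using 1
      ext (_ | _) <;> rfl
  obtain ⟨l, hl⟩ := key (finrank K V + 1)
  have := hl.fintype_card_le_finrank
  simp at this
  omega

/-- A basis consisting of vectors `ℓ i`, their images `f (ℓ i)`, and further vectors on which `f`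
compresses to a scalar `μ`; if `μ ≠ 0`, the span of the `ℓ i` and `f (ℓ i)` is invariant. -/
theorem exists_adapted_basis [FiniteDimensional K V] (f : End K V) :
    ∃ (m k : ℕ) (b : Basis ((Fin m ⊕ Fin m) ⊕ Fin k) K V) (μ : K),
      (∀ i, f (b (Sum.inl (Sum.inl i))) = b (Sum.inl (Sum.inr i))) ∧
      (∀ i j, b.repr (f (b (Sum.inr j))) (Sum.inr i) = if i = j then μ else 0) ∧
      (μ = 0 ∨ ∀ i j, b.repr (f (b (Sum.inl (Sum.inr j)))) (Sum.inr i) = 0) := by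
  obtain ⟨m, l, hl, hmax⟩ := exists_maximal_linearIndependent_apply f
  obtain ⟨k, b, hb⟩ := exists_basis_sum_fin hl
  have hbl : ∀ i, b (Sum.inl (Sum.inl i)) = l i := fun i => hb _
  have hbr : ∀ i, b (Sum.inl (Sum.inr i)) = f (l i) := fun i => hb _
  let p : V →ₗ[K] (Fin k → K) := LinearMap.funLeft K K Sum.inr ∘ₗ b.equivFun.toLinearMap
  have hp : ∀ x j, p x j = b.repr x (Sum.inr j) := fun x j => rfl
  let s : (Fin k → K) →ₗ[K] V := Fintype.linearCombination K (fun j => b (Sum.inr j))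
  have hps : ∀ u, p (s u) = u := by
    intro u
    ext j
    simp [hp, s, Fintype.linearCombination_apply, Finsupp.single_apply]
  have hpl : ∀ i, p (Sum.elim l (f ∘ l) i) = 0 := by
    intro i
    ext j
    rw [← hb, hp]
    simp
  have h : ∀ x, ¬ LinearIndependent K ![p x, p (f x)] := by
    intro x hx
    have h1 : LinearIndependent K fun j =>
        p (Sum.elim (fun _ : Unit => x) (fun _ : Unit => f x) j) := by
      have : (fun j => p (Sum.elim (fun _ : Unit => x) (fun _ : Unit => f x) j)) =
          Sum.elim (fun _ : Unit => p x) (fun _ : Unit => p (f x)) := by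
        ext (_ | _) <;> rfl
      rw [this]
      exact linearIndependent_sumElim_unit hx
    have h2 := (LinearIndependent.sumElim_of_map p hl hpl h1).comp _
      (Equiv.sumSumSumComm (Fin m) Unit (Fin m) Unit).injective
    refine hmax (Sum.elim l fun _ => x) ?_
    convert h2 using 1
    ext ((_ | _) | (_ | _)) <;> rfl
  rcases exists_scalar_or_exists_map_eq_zero f p s hps h with ⟨a, ha⟩ | ⟨rfl, x, hx, hfx⟩
  · refine ⟨m, k, b, a, fun i => by rw [hbl, hbr], fun i j => ?_, Or.inr fun i j => ?_⟩
    · rw [← hp, ha]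
      simp [hp, Finsupp.single_apply, eq_comm]
    · rw [← hp, ha]
      simp [hp]
  -- Here the quotient is a line: the last basis vector is replaced by `x`, which makes `μ = 0`.
  · have hli : LinearIndependent K (Sum.elim (Sum.elim l (f ∘ l)) (fun _ : Fin 1 => x)) :=
      LinearIndependent.sumElim_of_map p hl hpl (LinearIndependent.of_subsingleton 0 hx)
    have hcard := finrank_eq_card_basis b
    let b' := basisOfLinearIndependentOfCardEqFinrank hli hcard.symm
    have hb' : ∀ i, b' i = Sum.elim (Sum.elim l (f ∘ l)) (fun _ : Fin 1 => x) i := fun i => by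
      simp [b']
    refine ⟨m, 1, b', 0, fun i => by simp [hb'], fun i j => ?_, Or.inl rfl⟩
    have h1 := congrArg p (b'.sum_repr (f x))
    rw [hfx, map_sum, Fintype.sum_sum_type] at h1
    simp only [map_smul, hb', Sum.elim_inl, hpl, smul_zero, Finset.sum_const_zero, zero_add,
      Sum.elim_inr, Finset.univ_unique, Finset.sum_singleton, smul_eq_zero, hx, or_false] at h1
    rw [hb', Subsingleton.elim i default]
    simpa using h1

end AdaptedBasis

/-! ### Three idempotents always suffice -/

section Three

open Matrix Module

theorem LinCombIdem.of_conj {K R : Type*} [Field K] [Ring R] [Algebra K R] {m : ℕ} {x a b : R}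
    (hab : a * b = 1) (hba : b * a = 1) (h : LinCombIdem K m (b * x * a)) :
    LinCombIdem K m x := by
  obtain ⟨c, P, hP, h⟩ := h
  refine ⟨c, fun i => a * P i * b, fun i => ?_, ?_⟩
  · have : P i * P i = P i := hP i
    calc a * P i * b * (a * P i * b) = a * (P i * (b * a) * P i) * b := by simp only [mul_assoc]
      _ = a * P i * b := by rw [hba, mul_one, this]
  · calc x = (a * b) * x * (a * b) := by rw [hab]; simp
      _ = a * (b * x * a) * b := by simp only [mul_assoc]
      _ = _ := by rw [h, Finset.mul_sum, Finset.sum_mul]; simp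

/-- Every endomorphism of a finite-dimensional vector space is a linear combination of three
idempotents. -/
theorem linCombIdem_three {K V : Type*} [Field K] [AddCommGroup V] [Module K V]
    [FiniteDimensional K V] (f : End K V) : LinCombIdem K 3 f := by
  obtain ⟨m, k, b, μ, hL, hU, hρ⟩ := exists_adapted_basis f
  -- The blocks are reordered as `ℓ i`, then the extra vectors, then `f (ℓ i)`.
  let e : (Fin m ⊕ Fin m) ⊕ Fin k ≃ Fin m ⊕ (Fin k ⊕ Fin m) :=
    (Equiv.sumAssoc _ _ _).trans ((Equiv.refl _).sumCongr (Equiv.sumComm _ _))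
  let b' := b.reindex e
  refine (linCombIdem_algEquiv (LinearMap.toMatrixAlgEquiv b')).1 ?_
  set M := LinearMap.toMatrixAlgEquiv b' f with hM
  have hMap : ∀ i j, M i j = b.repr (f (b (e.symm j))) (e.symm i) := by
    intro i j
    simp [hM, b', LinearMap.toMatrixAlgEquiv_apply]
  set G : Matrix (Fin m) (Fin k ⊕ Fin m) K := M.toBlocks₁₂
  set H : Matrix (Fin m) (Fin k) K := M.toBlocks₂₂.toBlocks₂₁
  set T : Matrix (Fin m) (Fin m) K := M.toBlocks₂₂.toBlocks₂₂
  set ρ : Matrix (Fin k) (Fin m) K := M.toBlocks₂₂.toBlocks₁₂ with hρdef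
  have hMeq : M = fromBlocks 0 G (fromRows 0 1)
      (fromBlocks (algebraMap K (Matrix (Fin k) (Fin k) K) μ) ρ H T) := by
    rw [← fromBlocks_toBlocks M]
    congr 1
    · ext i j
      simp only [toBlocks₁₁, of_apply, hMap]
      simp [e, hL]
    · ext (i | i) j
      · simp only [toBlocks₂₁, of_apply, hMap]
        simp [e, hL]
      · simp only [toBlocks₂₁, of_apply, hMap]
        simp [e, hL, Finsupp.single_apply, one_apply, eq_comm]
    · rw [← fromBlocks_toBlocks M.toBlocks₂₂]
      congr 1
      ext i j
      simp only [toBlocks₁₁, toBlocks₂₂, of_apply, hMap]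
      simp [e, hU, algebraMap_matrix_apply]
  -- Since `f` carries the `ℓ i` identically onto the `f (ℓ i)`, a shear moves an arbitrary `N` from
  -- the block `T` to the zero block. The upper right part changes too, but its value is irrelevant.
  have conj : ∀ N : Matrix (Fin m) (Fin m) K, ∃ G₁ G₂, LinCombIdem K 3
      (fromBlocks N (fromCols G₁ G₂) (fromRows 0 1)
        (fromBlocks (algebraMap K (Matrix (Fin k) (Fin k) K) μ) ρ H (T - N))) →
      LinCombIdem K 3 M := by
    intro N
    set C : Matrix (Fin m) (Fin k ⊕ Fin m) K := fromCols 0 N with hC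
    set R : Matrix (Fin k ⊕ Fin m) (Fin m) K := fromRows 0 1 with hR
    set X := fromBlocks (1 : Matrix (Fin m) (Fin m) K) (-C) 0
      (1 : Matrix (Fin k ⊕ Fin m) (Fin k ⊕ Fin m) K)
    set Y := fromBlocks (1 : Matrix (Fin m) (Fin m) K) C 0
      (1 : Matrix (Fin k ⊕ Fin m) (Fin k ⊕ Fin m) K)
    have hXY : X * Y = 1 := by simp [X, Y, fromBlocks_multiply]
    have hYX : Y * X = 1 := by simp [X, Y, fromBlocks_multiply]
    have hCR : C * R = N := by simp [hC, hR, fromCols_mul_fromRows]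
    have hRC : R * C = fromBlocks 0 0 0 N := by
      ext (i | i) (j | j) <;> simp [hC, hR, fromRows_mul]
    have key : ∃ G', Y * M * X = fromBlocks N G' R
        (fromBlocks (algebraMap K (Matrix (Fin k) (Fin k) K) μ) ρ H (T - N)) := by
      refine ⟨N * -C + (G + C * fromBlocks (algebraMap K (Matrix (Fin k) (Fin k) K) μ) ρ H T), ?_⟩
      rw [hMeq]
      simp only [X, Y, fromBlocks_multiply, Matrix.one_mul, Matrix.mul_one, Matrix.mul_zero,
        Matrix.zero_mul, zero_add, add_zero, hCR, Matrix.mul_neg, hRC, fromBlocks_neg,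
        fromBlocks_add, neg_zero, neg_add_eq_sub]
    obtain ⟨G', hG'⟩ := key
    refine ⟨G'.toCols₁, G'.toCols₂, fun h => .of_conj hXY hYX ?_⟩
    rwa [hG', ← fromCols_toCols G']
  by_cases hμ : μ = 0
  · obtain ⟨N, Z, hNZ, hN, hZ⟩ :=
      exists_nilpotent_add m (Fin m) (by simp) (T - algebraMap K _ 1)
    obtain ⟨G₁, G₂, hG⟩ := conj N
    refine hG ?_
    -- For `μ = 0` the extra vectors join the nilpotent block, and the scalar on the last block is
    -- `c = 1`. For `μ ≠ 0` they join the last block, with `c = μ`.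
    refine (linCombIdem_algEquiv (reindexAlgEquiv K K (Equiv.sumAssoc _ _ _).symm)).1 ?_
    rw [← fromBlocks_toBlocks (reindexAlgEquiv K K _ _)]
    refine linCombIdem_three_fromBlocks one_ne_zero ?_ ?_ _ _
    · convert isNilpotent_fromBlocks_zero hN G₁ using 1
      ext (i | i) (j | j) <;> simp [toBlocks₁₁, hμ]
    · convert hZ using 1
      rw [eq_sub_of_add_eq' hNZ.symm]
      ext i j
      simp [toBlocks₂₂]
      abel
  · obtain ⟨N, Z, hNZ, hN, hZ⟩ :=
      exists_nilpotent_add m (Fin m) (by simp) (T - algebraMap K _ μ)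
    obtain ⟨G₁, G₂, hG⟩ := conj N
    refine hG ?_
    refine linCombIdem_three_fromBlocks hμ hN ?_ _ _
    have hρ0 : ρ = 0 := by
      ext i j
      simp only [hρdef, toBlocks₁₂, toBlocks₂₂, of_apply, hMap]
      simpa [e] using (hρ.resolve_left hμ) i j
    convert hZ.fromBlocks (IsNilpotent.zero (R := Matrix (Fin k) (Fin k) K)) H using 1
    rw [algebraMap_eq_fromBlocks, hρ0, eq_sub_of_add_eq' hNZ.symm, sub_eq_add_neg, fromBlocks_neg,
      fromBlocks_add]
    congr 1
    · simp
    · simp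
    · simp
    · abel

end Three

/-! ### Matrices that need more idempotents -/

section LowerBounds

open Matrix

variable {K : Type*} [Field K]

theorem not_linCombIdem_one_of_sq_eq_zero {R : Type*} [Ring R] [Algebra K R] {x : R}
    (hx : x ≠ 0) (h : x * x = 0) : ¬ LinCombIdem K 1 x := by
  intro hl
  obtain ⟨a, P, hP, rfl⟩ := hl.exists_of_one
  rw [smul_mul_smul_comm, hP.eq, ← smul_smul] at h
  rcases smul_eq_zero.1 h with rfl | h
  · exact hx (zero_smul _ _)
  · exact hx h

theorem exists_not_linCombIdem_one {n : ℕ} (hn : 2 ≤ n) :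
    ∃ A : Matrix (Fin n) (Fin n) K, ¬ LinCombIdem K 1 A := by
  obtain ⟨k, rfl⟩ := Nat.exists_eq_add_of_le' hn
  refine ⟨single 0 1 1, not_linCombIdem_one_of_sq_eq_zero ?_ ?_⟩
  · intro h
    simpa using congrFun (congrFun h 0) 1
  · rw [single_mul_single_of_ne]
    simp

/-- An element satisfying a cubic equation without roots is not a linear combination of two
idempotents. -/
theorem not_linCombIdem_two_of_cubic {R : Type*} [Ring R] [Nontrivial R] [Algebra K R] {u v w : K}
    (hno : ∀ x : K, x ^ 3 - u * x ^ 2 - v * x - w ≠ 0) {L : R}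
    (hL : L * (L * L) = u • (L * L) + v • L + w • 1) : ¬ LinCombIdem K 2 L := by
  intro h
  obtain ⟨a, b, P, Q, hP, hQ, hA⟩ := h.exists_of_two
  -- `L` has no eigenvalues in `K`, because its cubic has no root.
  have heig : ∀ (x : K) (M : R), L * M = x • M → M = 0 := by
    intro x M hM
    have h1 : L * (L * L) * M = (x ^ 3) • M := by
      simp only [mul_assoc, hM, mul_smul_comm, smul_smul]
      congr 1
      ring
    have h2 : L * (L * L) * M = (u * x ^ 2 + v * x + w) • M := by
      rw [hL]
      simp only [add_mul, smul_mul_assoc, mul_assoc, hM, mul_smul_comm, smul_smul, one_mul,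
        add_smul]
      congr 3
      ring
    have h3 : (x ^ 3 - u * x ^ 2 - v * x - w) • M = 0 := by
      rw [show x ^ 3 - u * x ^ 2 - v * x - w = x ^ 3 - (u * x ^ 2 + v * x + w) by ring, sub_smul,
        ← h1, h2, sub_self]
    exact (smul_eq_zero.1 h3).resolve_left (hno x)
  obtain ⟨hYP, hYQ⟩ := commute_sq_sub_of_idempotents hP hQ hA
  set s := a + b
  set y := L * L - s • L with hy
  -- This is minus the value of the cubic at `u - s`, hence nonzero. It is the coefficient that
  -- makes `L` a polynomial in `y`, so that `L` commutes with `P` and `Q`.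
  set δ := w + v * (u - s) + s * (u - s) ^ 2 with hδ
  have hδ0 : δ ≠ 0 := by
    have := hno (u - s)
    intro h0
    apply this
    linear_combination -h0 + hδ
  have hLy : δ • L = y * y - ((u - s) ^ 2 + v) • y - (u * w - 2 * s * w) • 1 := by
    have h4 : L * L * (L * L) = (u ^ 2 + v) • (L * L) + (u * v + w) • L + (u * w) • 1 := by
      rw [mul_assoc, hL]
      simp only [mul_add, mul_smul_comm, hL, mul_one, smul_add, smul_smul, add_smul, pow_two]
      abel
    have h3 : L * L * L = u • (L * L) + v • L + w • 1 := by rw [mul_assoc, hL]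
    rw [hy, sub_mul, mul_sub, mul_sub, h4, smul_mul_assoc, smul_mul_assoc, mul_smul_comm,
      mul_smul_comm, h3, hL]
    module
  have hcomm : ∀ T : R, Commute y T → Commute L T := by
    intro T hT
    have h1 : Commute (δ • L) T := by
      rw [hLy]
      exact ((hT.mul_left hT).sub_left (hT.smul_left _)).sub_left
        ((Commute.one_left T).smul_left _)
    have := h1.smul_left δ⁻¹
    rwa [smul_smul, inv_mul_cancel₀ hδ0, one_smul] at this
  have hLP := hcomm P hYP
  have hLQ := hcomm Q hYQ
  have hP' : P * P = P := hP
  have hQ' : Q * Q = Q := hQ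
  have hP0 : P * L = a • P + b • (P * Q) := by
    rw [hA, mul_add, mul_smul_comm, mul_smul_comm, hP']
  have hQ0 : L * Q = a • (P * Q) + b • Q := by
    rw [hA, add_mul, smul_mul_assoc, smul_mul_assoc, hQ']
  have hPQ : P * Q = 0 := by
    refine heig (a + b) _ ?_
    rw [← mul_assoc, hLP.eq, mul_assoc, hQ0, mul_add, mul_smul_comm, mul_smul_comm, ← mul_assoc,
      hP', add_smul]
  rw [hPQ, smul_zero, add_zero] at hP0
  rw [hPQ, smul_zero, zero_add] at hQ0
  have hPz : P = 0 := heig a P (by rw [hLP.eq, hP0])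
  have hQz : Q = 0 := heig b Q hQ0
  have hLz : L = 0 := by rw [hA, hPz, hQz]; simp
  exact one_ne_zero (heig 0 1 (by rw [hLz]; simp))

/-- A direct summand `L` satisfying a cubic equation without roots inherits decompositions into
linear combinations of two idempotents. -/
theorem not_linCombIdem_two_fromBlocks_of_cubic {α β : Type*} [Fintype α] [DecidableEq α]
    [Nonempty α] [Fintype β] [DecidableEq β] {u v w : K}
    (hno : ∀ x : K, x ^ 3 - u * x ^ 2 - v * x - w ≠ 0) {L : Matrix α α K}
    (hL : L * (L * L) = u • (L * L) + v • L + w • 1) :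
    ¬ LinCombIdem K 2 (fromBlocks L 0 0 (0 : Matrix β β K)) := by
  intro h
  obtain ⟨a, b, P, Q, hP, hQ, hA⟩ := h.exists_of_two
  obtain ⟨hYP, hYQ⟩ := commute_sq_sub_of_idempotents hP hQ hA
  have heig : ∀ (x : K) (M : Matrix α β K), L * M = x • M → M = 0 := by
    intro x M hM
    have h1 : L * (L * L) * M = (x ^ 3) • M := by
      simp only [Matrix.mul_assoc, hM, Matrix.mul_smul, smul_smul]
      congr 1
      ring
    have h2 : L * (L * L) * M = (u * x ^ 2 + v * x + w) • M := by
      rw [hL]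
      simp only [Matrix.add_mul, Matrix.smul_mul, Matrix.mul_assoc, hM, Matrix.mul_smul, smul_smul,
        Matrix.one_mul, add_smul]
      congr 3
      ring
    have h3 : (x ^ 3 - u * x ^ 2 - v * x - w) • M = 0 := by
      rw [show x ^ 3 - u * x ^ 2 - v * x - w = x ^ 3 - (u * x ^ 2 + v * x + w) by ring, sub_smul,
        ← h1, h2, sub_self]
    exact (smul_eq_zero.1 h3).resolve_left (hno x)
  have hcorner : ∀ T : Matrix (α ⊕ β) (α ⊕ β) K, IsIdempotentElem T →
      Commute (fromBlocks L 0 0 (0 : Matrix β β K) * fromBlocks L 0 0 (0 : Matrix β β K) -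
        (a + b) • fromBlocks L 0 0 (0 : Matrix β β K)) T → IsIdempotentElem T.toBlocks₁₁ := by
    intro T hT hc
    have hT' : T * T = T := hT
    rw [← fromBlocks_toBlocks T] at hT' hc
    rw [Commute, SemiconjBy, fromBlocks_smul, sub_eq_add_neg, fromBlocks_neg, fromBlocks_multiply,
      fromBlocks_add, fromBlocks_multiply, fromBlocks_multiply, fromBlocks_inj] at hc
    rw [fromBlocks_multiply, fromBlocks_inj] at hT'
    have h12 := hc.2.1
    simp only [Matrix.mul_zero, Matrix.zero_mul, add_zero, smul_zero, neg_zero,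
      ← sub_eq_add_neg, Matrix.sub_mul, sub_eq_zero, Matrix.smul_mul, Matrix.mul_assoc] at h12
    -- Commutation gives `L (L - (a + b)) T₁₂ = 0`, and neither `0` nor `a + b` is an eigenvalue of
    -- `L`.
    have h0 : T.toBlocks₁₂ = 0 := by
      have h1 : L * T.toBlocks₁₂ - (a + b) • T.toBlocks₁₂ = 0 := by
        refine heig 0 _ ?_
        rw [Matrix.mul_sub, Matrix.mul_smul, h12, sub_self, zero_smul]
      exact heig (a + b) _ (sub_eq_zero.1 h1)
    have h11 := hT'.1
    rwa [h0, Matrix.zero_mul, add_zero] at h11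
  refine not_linCombIdem_two_of_cubic hno hL ?_
  convert linCombIdem_two_of_add a b (hcorner P hP hYP) (hcorner Q hQ hYQ) using 1
  have := congrArg toBlocks₁₁ hA
  rw [toBlocks_fromBlocks₁₁] at this
  rw [this]
  rfl

theorem exists_not_linCombIdem_two_of_not_everyCubicHasRoot {n : ℕ} (hn : 3 ≤ n)
    (h : ¬ EveryCubicHasRoot K) : ∃ A : Matrix (Fin n) (Fin n) K, ¬ LinCombIdem K 2 A := by
  obtain ⟨k, rfl⟩ := Nat.exists_eq_add_of_le hn
  simp only [EveryCubicHasRoot] at h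
  push Not at h
  obtain ⟨p, hp, hroot⟩ := h
  have hpn : p.natDegree = 3 := Polynomial.natDegree_eq_of_degree_eq_some hp
  have hc : p.coeff 3 ≠ 0 := by
    rw [← hpn, Polynomial.coeff_natDegree, Polynomial.leadingCoeff_ne_zero]
    rintro rfl
    simp at hp
  set u := -(p.coeff 2 / p.coeff 3)
  set v := -(p.coeff 1 / p.coeff 3)
  set w := -(p.coeff 0 / p.coeff 3)
  have hno : ∀ x : K, x ^ 3 - u * x ^ 2 - v * x - w ≠ 0 := by
    intro x hx
    apply hroot x
    rw [Polynomial.IsRoot, Polynomial.eval_eq_sum_range, hpn]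
    simp only [Finset.sum_range_succ, Finset.sum_range_zero]
    have : p.coeff 3 * (x ^ 3 - u * x ^ 2 - v * x - w) = 0 := by rw [hx, mul_zero]
    simp only [u, v, w] at this
    field_simp at this
    linear_combination this
  refine ⟨reindexAlgEquiv K K finSumFinEquiv
    (fromBlocks !![0, 0, w; 1, 0, v; 0, 1, u] 0 0 (0 : Matrix (Fin k) (Fin k) K)), ?_⟩
  rw [linCombIdem_algEquiv]
  refine not_linCombIdem_two_fromBlocks_of_cubic hno ?_
  ext i j
  fin_cases i <;> fin_cases j <;> simp [Matrix.mul_apply, Fin.sum_univ_three] <;> ring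

/-- If `X² - (a + b) X` takes at `d i` a value not taken at any other `d j`, then commutation kills
the off-diagonal entries of row `i` of `P` and `Q`. Their diagonal entries there are then `0` or
`1`. -/
theorem diagonal_entry_of_linCombIdem_two {ι : Type*} [Fintype ι] [DecidableEq ι] {d : ι → K}
    (h : LinCombIdem K 2 (diagonal d)) : ∃ a b : K, ∀ i,
      (d i = 0 ∨ d i = a ∨ d i = b ∨ d i = a + b) ∨
        ∃ j, j ≠ i ∧ (d j = d i ∨ d i + d j = a + b) := by
  obtain ⟨a, b, P, Q, hP, hQ, hA⟩ := h.exists_of_two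
  obtain ⟨hYP, hYQ⟩ := commute_sq_sub_of_idempotents hP hQ hA
  refine ⟨a, b, fun i => or_iff_not_imp_right.2 fun hi => ?_⟩
  push Not at hi
  have key : ∀ T : Matrix ι ι K, IsIdempotentElem T →
      Commute (diagonal d * diagonal d - (a + b) • diagonal d) T → T i i = 0 ∨ T i i = 1 := by
    intro T hT hc
    rw [diagonal_mul_diagonal, ← diagonal_smul, diagonal_sub] at hc
    have h0 : ∀ j, j ≠ i → T i j = 0 := by
      intro j hj
      have h1 := congrFun (congrFun hc i) j
      rw [diagonal_mul, mul_diagonal] at h1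
      simp only [Pi.smul_apply, smul_eq_mul] at h1
      have h2 : (d j - d i) * (d i + d j - (a + b)) * T i j = 0 := by linear_combination -h1
      rcases mul_eq_zero.1 h2 with h3 | h3
      · rcases mul_eq_zero.1 h3 with h4 | h4
        · exact absurd (sub_eq_zero.1 h4) (hi j hj).1
        · exact absurd (sub_eq_zero.1 h4) (hi j hj).2
      · exact h3
    have h1 : (T * T) i i = T i i := by rw [hT.eq]
    rw [Matrix.mul_apply, Finset.sum_eq_single i (fun j _ hj => by rw [h0 j hj, zero_mul])
      (by simp)] at h1
    have h2 : T i i * (T i i - 1) = 0 := by linear_combination h1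
    simpa [sub_eq_zero] using h2
  have hd := congrFun (congrFun hA i) i
  simp only [diagonal_apply_eq, Matrix.add_apply, Matrix.smul_apply, smul_eq_mul] at hd
  rcases key P hP hYP with hp | hp <;> rcases key Q hQ hYQ with hq | hq <;> simp [hd, hp, hq]

/-- On a finite field `x ↦ x³ - x` would be surjective, hence injective, yet it takes the same value
at `0` and `1`. -/
theorem EveryCubicHasRoot.infinite (h : EveryCubicHasRoot K) : Infinite K := by
  by_contra hinf
  rw [not_infinite_iff_finite] at hinf
  have hsurj : Function.Surjective (fun x : K => x ^ 3 - x) := by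
    intro c
    obtain ⟨x, hx⟩ := h (Polynomial.X ^ 3 - Polynomial.X - Polynomial.C c) (by compute_degree!)
    refine ⟨x, ?_⟩
    simp only [Polynomial.IsRoot, Polynomial.eval_sub, Polynomial.eval_pow, Polynomial.eval_X,
      Polynomial.eval_C] at hx
    linear_combination hx
  have hinj := Finite.injective_iff_surjective.2 hsurj
  exact zero_ne_one (hinj (show (0 : K) ^ 3 - 0 = 1 ^ 3 - 1 by ring))

/-- Four elements without small additive coincidences cannot all be equal to `a`, `b`, `a + b`,
or paired with another one to the sum `a + b`. -/
theorem false_of_four_generic {G : Type*} [AddCommGroup G] {x y z t a b s : G} (hs : s = a + b)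
    (h1 : x ≠ y ∧ x ≠ z ∧ x ≠ t ∧ y ≠ z ∧ y ≠ t ∧ z ≠ t)
    (h2 : x + y ≠ z ∧ x + z ≠ y ∧ y + z ≠ x ∧ x + y ≠ t ∧ x + z ≠ t ∧ y + z ≠ t)
    (h3 : x + t ≠ y ∧ x + t ≠ z ∧ y + t ≠ x ∧ y + t ≠ z ∧ z + t ≠ x ∧ z + t ≠ y)
    (h4 : x + y ≠ z + t ∧ x + z ≠ y + t ∧ y + z ≠ x + t)
    (h0 : x ≠ 0 ∧ y ≠ 0 ∧ z ≠ 0 ∧ t ≠ 0)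
    (hx : x = s ∨ x = a ∨ x = b ∨ x + y = s ∨ x + z = s ∨ x + t = s)
    (hy : y = s ∨ y = a ∨ y = b ∨ x + y = s ∨ y + z = s ∨ y + t = s)
    (hz : z = s ∨ z = a ∨ z = b ∨ x + z = s ∨ y + z = s ∨ z + t = s)
    (ht : t = s ∨ t = a ∨ t = b ∨ x + t = s ∨ y + t = s ∨ z + t = s) : False := by
  -- If one element equals `s`, no pair can sum to `s`, so three distinct elements lie in `{a, b}`.
  -- Otherwise at most one pair sums to `s`; the other two would be `a` and `b` and also sum to `s`,
  -- against `h4`.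
  by_cases hxs : x = s
  · grind
  by_cases hys : y = s
  · grind
  by_cases hzs : z = s
  · grind
  by_cases hts : t = s
  · grind
  clear h0 h2 h3
  grind

/-- In an infinite field there are four elements without small additive coincidences. -/
theorem exists_four_generic [Infinite K] : ∃ x y z t : K,
    (x ≠ 0 ∧ y ≠ 0 ∧ z ≠ 0 ∧ t ≠ 0) ∧ (x ≠ y ∧ x ≠ z ∧ x ≠ t ∧ y ≠ z ∧ y ≠ t ∧ z ≠ t) ∧
    (x + y ≠ z ∧ x + z ≠ y ∧ y + z ≠ x ∧ x + y ≠ t ∧ x + z ≠ t ∧ y + z ≠ t) ∧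
    (x + t ≠ y ∧ x + t ≠ z ∧ y + t ≠ x ∧ y + t ≠ z ∧ z + t ≠ x ∧ z + t ≠ y) ∧
    (x + y ≠ z + t ∧ x + z ≠ y + t ∧ y + z ≠ x + t) := by
  classical
  obtain ⟨x, hx⟩ := Infinite.exists_notMem_finset ({0} : Finset K)
  obtain ⟨y, hy⟩ := Infinite.exists_notMem_finset ({0, x} : Finset K)
  obtain ⟨z, hz⟩ := Infinite.exists_notMem_finset ({0, x, y, x + y, x - y, y - x} : Finset K)
  obtain ⟨t, ht⟩ := Infinite.exists_notMem_finset ({0, x, y, z, x + y, x + z, y + z, y - x, z - x,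
    x - y, z - y, x - z, y - z, x + y - z, x + z - y, y + z - x} : Finset K)
  simp only [Finset.mem_insert, Finset.mem_singleton, not_or] at hx hy hz ht
  refine ⟨x, y, z, t, ?_, ?_, ?_, ?_, ?_⟩ <;> grind

theorem exists_not_linCombIdem_two_of_infinite [Infinite K] {n : ℕ} (hn : 4 ≤ n) :
    ∃ A : Matrix (Fin n) (Fin n) K, ¬ LinCombIdem K 2 A := by
  obtain ⟨k, rfl⟩ := Nat.exists_eq_add_of_le hn
  obtain ⟨x, y, z, t, h0, h1, h2, h3, h4⟩ := exists_four_generic (K := K)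
  refine ⟨reindexAlgEquiv K K finSumFinEquiv
    (diagonal (Sum.elim ![x, y, z, t] (fun _ : Fin k => 0))), ?_⟩
  rw [linCombIdem_algEquiv]
  intro h
  obtain ⟨a, b, hab⟩ := diagonal_entry_of_linCombIdem_two h
  have hx := hab (Sum.inl 0)
  have hy := hab (Sum.inl 1)
  have hz := hab (Sum.inl 2)
  have ht := hab (Sum.inl 3)
  simp [Fin.exists_fin_succ, h0, h1, h1.1.symm, h1.2.1.symm, h1.2.2.1.symm, h1.2.2.2.1.symm,
    h1.2.2.2.2.1.symm, h1.2.2.2.2.2.symm] at hx hy hz ht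
  refine false_of_four_generic (s := a + b) rfl h1 h2 h3 h4 h0 ?_ ?_ ?_ ?_
  · clear hy hz ht
    grind
  · clear hx hz ht
    grind
  · clear hx hy ht
    grind
  · clear hx hy hz
    grind

/-- The only serious case is `A = P + Q`. Then `PQ + QP = 1`, which makes `P` and `Q` commute, so
that `1 = 2 PQ = 0`. -/
theorem not_linCombIdem_two_of_two_elements {R : Type*} [Ring R] [Nontrivial R] [Algebra K R]
    (hK : ∀ x : K, x = 0 ∨ x = 1) {A : R} (hA : A * A = A + 1) : ¬ LinCombIdem K 2 A := by
  intro h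
  obtain ⟨a, b, P, Q, hP, hQ, rfl⟩ := h.exists_of_two
  have hP' : P * P = P := hP
  have hQ' : Q * Q = Q := hQ
  have h2 : (1 : K) + 1 = 0 := (hK (1 + 1)).resolve_right (by simp)
  rcases hK a with rfl | rfl <;> rcases hK b with rfl | rfl
  · simp at hA
  · simp [hQ'] at hA
  · simp [hP'] at hA
  · simp only [one_smul, add_mul, mul_add, hP', hQ'] at hA
    have hs : P * Q + Q * P = 1 := by
      have : P + Q + (P * Q + Q * P) = P + Q + 1 := by rw [← hA]; abel
      exact add_left_cancel this
    have h3 : P * Q + P * Q * P = P := by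
      have := congrArg (fun x => P * x) hs
      simpa [mul_add, ← mul_assoc, hP'] using this
    have h4 : P * Q * P + Q * P = P := by
      have := congrArg (fun x => x * P) hs
      simpa [add_mul, mul_assoc, hP'] using this
    have h5 : Q * P = P * Q := by
      have : P * Q * P + Q * P = P * Q * P + P * Q := by rw [h4, add_comm, h3]
      exact add_left_cancel this
    rw [h5, ← two_smul K, show (2 : K) = 1 + 1 by norm_num, h2, zero_smul] at hs
    exact zero_ne_one hs

theorem eq_zero_or_one_of_card_le_two (h : ¬ 2 < ENat.card K) (x : K) : x = 0 ∨ x = 1 := by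
  by_contra! hx
  apply h
  have h1 : ({0, 1, x} : Set K).encard = 3 := by
    rw [Set.encard_eq_three]
    exact ⟨0, 1, x, zero_ne_one, hx.1.symm, hx.2.symm, rfl⟩
  have h2 : ({0, 1, x} : Set K).encard ≤ ENat.card K := by
    rw [← Set.encard_univ]
    exact Set.encard_le_encard (Set.subset_univ _)
  rw [h1] at h2
  exact lt_of_lt_of_le (by norm_num) h2

theorem exists_ne_ne_of_two_lt_card {α : Type*} (h : 2 < ENat.card α) (x y : α) : ∃ z, z ≠ x ∧ z ≠ y := by
  by_contra! hz
  have h1 : (Set.univ : Set α) ⊆ {x, y} := fun z _ => or_iff_not_imp_left.2 (hz z)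
  have h2 := (Set.encard_le_encard h1).trans (Set.encard_insert_le {y} x)
  rw [Set.encard_univ, Set.encard_singleton, one_add_one_eq_two] at h2
  exact absurd h (not_lt.2 h2)

theorem exists_not_linCombIdem_two_of_card_le_two (h : ¬ 2 < ENat.card K) :
    ∃ A : Matrix (Fin 2) (Fin 2) K, ¬ LinCombIdem K 2 A := by
  have hK := eq_zero_or_one_of_card_le_two h
  refine ⟨!![0, 1; 1, 1], not_linCombIdem_two_of_two_elements hK ?_⟩
  have h2 : (1 : K) + 1 = 0 := (hK (1 + 1)).resolve_right (by simp)
  ext i j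
  fin_cases i <;> fin_cases j <;> simp [Matrix.mul_apply, Fin.sum_univ_two, h2]

end LowerBounds

/-! ### Two idempotents in sizes 2 and 3 -/

section SmallSizes

open Matrix Module

variable {K : Type*} [Field K]

theorem linCombIdem_two_of_smul_idempotents {R : Type*} [Ring R] [Algebra K R] {a b : K}
    (ha : a ≠ 0) (hb : b ≠ 0) {X Y : R} (hX : X * X = a • X) (hY : Y * Y = b • Y) :
    LinCombIdem K 2 (X + Y) := by
  have h1 : IsIdempotentElem (a⁻¹ • X) := by
    rw [IsIdempotentElem, smul_mul_smul_comm, hX, smul_smul, mul_assoc, inv_mul_cancel₀ ha, mul_one]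
  have h2 : IsIdempotentElem (b⁻¹ • Y) := by
    rw [IsIdempotentElem, smul_mul_smul_comm, hY, smul_smul, mul_assoc, inv_mul_cancel₀ hb, mul_one]
  simpa [smul_smul, mul_inv_cancel₀ ha, mul_inv_cancel₀ hb] using linCombIdem_two_of_add a b h1 h2

theorem exists_add_eq_of_ne {K : Type*} [Field K] (hK : ∀ x y : K, ∃ z, z ≠ x ∧ z ≠ y) (t : K) :
    ∃ a b : K, a ≠ 0 ∧ b ≠ 0 ∧ t = a + b := by
  obtain ⟨a, ha, hat⟩ := hK 0 t
  exact ⟨a, t - a, ha, sub_ne_zero.2 hat.symm, by ring⟩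

/-- In a basis `v, f v` the matrix splits by rows into two rank-one pieces whose traces can be
chosen nonzero, because `K` has more than two elements. -/
theorem linCombIdem_two_fin_two (hK : ∀ x y : K, ∃ z, z ≠ x ∧ z ≠ y)
    (A : Matrix (Fin 2) (Fin 2) K) : LinCombIdem K 2 A := by
  refine (linCombIdem_algEquiv toLinAlgEquiv').1 ?_
  set f := toLinAlgEquiv' A
  by_cases hf : ∃ a, f = algebraMap K _ a
  · obtain ⟨a, ha⟩ := hf
    rw [ha]
    exact (linCombIdem_one_algebraMap a).mono one_le_two
  · push Not at hf
    obtain ⟨v, hv⟩ := exists_linearIndependent_apply_of_ne_algebraMap hf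
    let b := basisOfLinearIndependentOfCardEqFinrank hv (by simp)
    have hb : ∀ i, b i = ![v, f v] i := fun i => by simp [b]
    refine (linCombIdem_algEquiv (LinearMap.toMatrixAlgEquiv b)).1 ?_
    set M := LinearMap.toMatrixAlgEquiv b f with hM
    have hM0 : ∀ i, M i 0 = if i = 1 then 1 else 0 := by
      intro i
      have h1 : f (b 0) = b 1 := by simp [hb]
      rw [hM, LinearMap.toMatrixAlgEquiv_apply, h1, b.repr_self, Finsupp.single_apply]
      simp [eq_comm]
    obtain ⟨x, y, hx, hy, hxy⟩ := exists_add_eq_of_ne hK (M 1 1)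
    have hsum : M = !![0, M 0 1; 0, x] + !![0, 0; 1, y] := by
      ext i j
      fin_cases i <;> fin_cases j <;> simp [hM0, hxy]
    rw [hsum]
    refine linCombIdem_two_of_smul_idempotents hx hy ?_ ?_ <;> ext i j <;> fin_cases i <;>
      fin_cases j <;> simp [Matrix.mul_apply, Fin.sum_univ_two, mul_comm]

/-- For `x = y` this is scalar plus nilpotent; otherwise `M` is `x` plus `y - x` times a spectral
projection. -/
theorem linCombIdem_two_of_mul_sub_eq_zero {ι : Type*} [Fintype ι] [DecidableEq ι]
    {M : Matrix ι ι K} {x y : K} (h : (M - x • 1) * (M - y • 1) = 0) : LinCombIdem K 2 M := by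
  rcases eq_or_ne y x with rfl | hxy
  · have := linCombIdem_two_algebraMap_add_nilpotent y (N := M - y • 1) ⟨2, by rw [pow_two, h]⟩
    rwa [Algebra.algebraMap_eq_smul_one, add_sub_cancel] at this
  · set R := M - x • 1 with hR
    have hRR : R * R = (y - x) • R := by
      have h1 : M - y • 1 = R - (y - x) • 1 := by rw [hR, sub_smul]; abel
      rw [h1, mul_sub, mul_smul_comm, mul_one, sub_eq_zero] at h
      exact h
    have hidem : IsIdempotentElem ((y - x)⁻¹ • R) := by
      rw [IsIdempotentElem, smul_mul_smul_comm, hRR, smul_smul, mul_assoc,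
        inv_mul_cancel₀ (sub_ne_zero.2 hxy), mul_one]
    have := linCombIdem_two_of_add x (y - x) IsIdempotentElem.one hidem
    rwa [smul_smul, mul_inv_cancel₀ (sub_ne_zero.2 hxy), one_smul, hR, add_sub_cancel] at this

/-- A `3 × 3` companion matrix is a linear combination of two idempotents if its characteristic
polynomial has a root `r`. -/
theorem linCombIdem_two_companion (hK : ∀ x y : K, ∃ z, z ≠ x ∧ z ≠ y) {u v w r : K}
    (hr : r ^ 3 - u * r ^ 2 - v * r - w = 0) (hw : w = 0 → r = 0) :
    LinCombIdem K 2 !![0, 0, w; 1, 0, v; 0, 1, u] := by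
  -- The cubic factors as `(X - r)(X² - s X + d)`, and the conjugate is block triangular with
  -- diagonal blocks belonging to these factors.
  set s := u - r with hs
  set d := -v - r * s with hd
  have hwd : w = r * d := by
    rw [hd, hs]
    linear_combination -hr
  have hv : v = -d - r * s := by rw [hd]; ring
  have hu : u = s + r := by rw [hs]; ring
  refine LinCombIdem.of_conj (a := !![1, 0, d; 0, 1, -s; 0, 0, 1])
    (b := !![1, 0, -d; 0, 1, s; 0, 0, 1]) ?_ ?_ ?_
  · ext i j
    fin_cases i <;> fin_cases j <;> simp [Matrix.mul_apply, Fin.sum_univ_three]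
  · ext i j
    fin_cases i <;> fin_cases j <;> simp [Matrix.mul_apply, Fin.sum_univ_three]
  have hconj : (!![1, 0, -d; 0, 1, s; 0, 0, 1] * !![0, 0, w; 1, 0, v; 0, 1, u] *
      !![1, 0, d; 0, 1, -s; 0, 0, 1] : Matrix (Fin 3) (Fin 3) K) =
      !![0, -d, 0; 1, s, 0; 0, 1, r] := by
    rw [hwd, hv, hu]
    ext i j
    fin_cases i <;> fin_cases j <;> simp [Matrix.mul_apply, Fin.sum_univ_three] <;> ring
  rw [hconj]
  clear hconj
  clear_value s d
  rcases eq_or_ne r 0 with rfl | hr0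
  · obtain ⟨a, b, ha, hb, rfl⟩ := exists_add_eq_of_ne hK s
    have hsum : (!![0, -d, 0; 1, a + b, 0; 0, 1, 0] : Matrix (Fin 3) (Fin 3) K) =
        !![0, -d, 0; 0, a, 0; 0, 1, 0] + !![0, 0, 0; 1, b, 0; 0, 0, 0] := by
      ext i j
      fin_cases i <;> fin_cases j <;> simp
    rw [hsum]
    refine linCombIdem_two_of_smul_idempotents ha hb ?_ ?_ <;> ext i j <;> fin_cases i <;>
      fin_cases j <;> simp [Matrix.mul_apply, Fin.sum_univ_three, mul_comm]
  · rcases eq_or_ne s r with rfl | hsr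
    · have hd0 : d ≠ 0 := fun h => hr0 (hw (by rw [hwd, h, mul_zero]))
      obtain ⟨a, b, ha, hb, rfl⟩ := exists_add_eq_of_ne hK s
      -- The entry `a / d` is forced by requiring the first summand to square to `a` times itself;
      -- hence the need for `d ≠ 0`.
      have hsum : (!![0, -d, 0; 1, a + b, 0; 0, 1, a + b] : Matrix (Fin 3) (Fin 3) K) =
          !![0, -d, 0; 0, a, 0; a / d, 1, a] + !![0, 0, 0; 1, b, 0; -(a / d), 0, b] := by
        ext i j
        fin_cases i <;> fin_cases j <;> simp
      rw [hsum]
      refine linCombIdem_two_of_smul_idempotents ha hb ?_ ?_ <;> ext i j <;> fin_cases i <;>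
        fin_cases j <;> simp [Matrix.mul_apply, Fin.sum_univ_three, mul_comm]
      field_simp
      ring
    · have hsum : (!![0, -d, 0; 1, s, 0; 0, 1, r] : Matrix (Fin 3) (Fin 3) K) =
          !![0, -d, 0; 0, s - r, 0; 0, 1, 0] + !![0, 0, 0; 1, r, 0; 0, 0, r] := by
        ext i j
        fin_cases i <;> fin_cases j <;> simp
      rw [hsum]
      refine linCombIdem_two_of_smul_idempotents (sub_ne_zero.2 hsr) hr0 ?_ ?_ <;> ext i j <;>
        fin_cases i <;> fin_cases j <;> simp [Matrix.mul_apply, Fin.sum_univ_three, mul_comm]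

/-- A `3 × 3` matrix in block triangular form without a cyclic vector is annihilated by a split
quadratic polynomial. -/
theorem exists_mul_sub_eq_zero_of_no_cyclic {p q t g h : K}
    (hcyc : ∀ m₁ m₂ : K, ¬ LinearIndependent K ![![m₁, m₂, 1],
      !![0, p, g; 1, t, h; 0, 0, q] *ᵥ ![m₁, m₂, 1],
      !![0, p, g; 1, t, h; 0, 0, q] *ᵥ (!![0, p, g; 1, t, h; 0, 0, q] *ᵥ ![m₁, m₂, 1])]) :
    ∃ x y : K, ((!![0, p, g; 1, t, h; 0, 0, q] : Matrix (Fin 3) (Fin 3) K) - x • 1) *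
      (!![0, p, g; 1, t, h; 0, 0, q] - y • 1) = 0 := by
  -- Up to sign this is the determinant of `m, M m, M² m`. It is a quadratic form in the first two
  -- coordinates of `(M - q) m`, whose third coordinate is zero.
  have key : ∀ m₁ m₂ : K, (p * m₂ + g - q * m₁) ^ 2 +
      t * (p * m₂ + g - q * m₁) * (m₁ + (t - q) * m₂ + h) -
      p * (m₁ + (t - q) * m₂ + h) ^ 2 = 0 := by
    intro m₁ m₂
    by_contra hne
    refine hcyc m₁ m₂ ?_
    refine (linearIndependent_rows_iff_isUnit (A := of ![![m₁, m₂, 1],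
      !![0, p, g; 1, t, h; 0, 0, q] *ᵥ ![m₁, m₂, 1],
      !![0, p, g; 1, t, h; 0, 0, q] *ᵥ (!![0, p, g; 1, t, h; 0, 0, q] *ᵥ ![m₁, m₂, 1])])).2 ?_
    rw [isUnit_iff_isUnit_det, isUnit_iff_ne_zero]
    intro hdet
    apply hne
    rw [det_fin_three] at hdet
    simp [dotProduct, Fin.sum_univ_three] at hdet
    linear_combination hdet
  have hD : q ^ 2 - t * q - p = 0 := by
    by_contra hD
    -- If `q` is not a root of `X² - t X - p`, some `m` has `(M - q) m` equal to the first basis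
    -- vector, where the form is `1`.
    obtain ⟨m, hm⟩ : ∃ m, (q ^ 2 - t * q - p) * m = g + q * h - 1 :=
      ⟨(g + q * h - 1) / (q ^ 2 - t * q - p), mul_div_cancel₀ _ hD⟩
    have h1 : p * m + g - q * (-(t - q) * m - h) = 1 := by linear_combination -hm
    have h2 := key (-(t - q) * m - h) m
    rw [h1, show -(t - q) * m - h + (t - q) * m + h = 0 by ring] at h2
    simp at h2
  obtain ⟨y, rfl⟩ : ∃ y, t = q + y := ⟨t - q, by ring⟩
  obtain rfl : p = -(q * y) := by linear_combination -hD
  have hg : g + q * h = 0 := by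
    by_contra hκ
    -- The form now factors, with the first factor constantly `g + q h`. Evaluating at two points
    -- gives the contradiction.
    have h0 : (g + q * h) * (g + y * h) = 0 := by linear_combination key 0 0
    have h1 : (g + q * h) * (g + y * h + y - q) = 0 := by linear_combination key 1 0
    have h2 := (mul_eq_zero.1 h0).resolve_left hκ
    have h3 := (mul_eq_zero.1 h1).resolve_left hκ
    obtain rfl : y = q := by linear_combination h3 - h2
    exact hκ h2
  obtain rfl : g = -(q * h) := by linear_combination hg
  refine ⟨q, y, ?_⟩
  ext i j
  fin_cases i <;> fin_cases j <;> simp [Matrix.mul_apply, Fin.sum_univ_three] <;> ring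

theorem linCombIdem_two_fin_three (hroot : EveryCubicHasRoot K) (A : Matrix (Fin 3) (Fin 3) K) :
    LinCombIdem K 2 A := by
  classical
  have hinf := hroot.infinite
  have hK : ∀ x y : K, ∃ z, z ≠ x ∧ z ≠ y := by
    intro x y
    obtain ⟨z, hz⟩ := Infinite.exists_notMem_finset ({x, y} : Finset K)
    exact ⟨z, by simpa using hz⟩
  refine (linCombIdem_algEquiv toLinAlgEquiv').1 ?_
  set f := toLinAlgEquiv' A
  by_cases hf : ∃ a, f = algebraMap K _ a
  · obtain ⟨a, ha⟩ := hf
    rw [ha]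
    exact (linCombIdem_one_algebraMap a).mono one_le_two
  push Not at hf
  by_cases hcyc : ∃ v, LinearIndependent K ![v, f v, f (f v)]
  · obtain ⟨v, hv⟩ := hcyc
    let b := basisOfLinearIndependentOfCardEqFinrank hv (by simp)
    have hb : ∀ i, b i = ![v, f v, f (f v)] i := fun i => by simp [b]
    refine (linCombIdem_algEquiv (LinearMap.toMatrixAlgEquiv b)).1 ?_
    set M := LinearMap.toMatrixAlgEquiv b f with hM
    have hM0 : ∀ i, M i 0 = if i = 1 then 1 else 0 := by
      intro i
      have h1 : f (b 0) = b 1 := by simp [hb]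
      rw [hM, LinearMap.toMatrixAlgEquiv_apply, h1, b.repr_self, Finsupp.single_apply]
      simp [eq_comm]
    have hM1 : ∀ i, M i 1 = if i = 2 then 1 else 0 := by
      intro i
      have h1 : f (b 1) = b 2 := by simp [hb]
      rw [hM, LinearMap.toMatrixAlgEquiv_apply, h1, b.repr_self, Finsupp.single_apply]
      simp [eq_comm]
    have hMeq : M = !![0, 0, M 0 2; 1, 0, M 1 2; 0, 1, M 2 2] := by
      ext i j
      fin_cases i <;> fin_cases j <;> simp [hM0, hM1]
    rw [hMeq]
    -- The root must be `0` whenever the constant term vanishes, so that root is chosen explicitly.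
    by_cases hw : M 0 2 = 0
    · exact linCombIdem_two_companion hK (r := 0) (by simp [hw]) fun _ => rfl
    · obtain ⟨r, hr⟩ := hroot (Polynomial.X ^ 3 - Polynomial.C (M 2 2) * Polynomial.X ^ 2 -
        Polynomial.C (M 1 2) * Polynomial.X - Polynomial.C (M 0 2)) (by compute_degree!)
      exact linCombIdem_two_companion hK (by simpa [Polynomial.IsRoot] using hr)
        fun h => absurd h hw
  · push Not at hcyc
    obtain ⟨v, hv⟩ := exists_linearIndependent_apply_of_ne_algebraMap hf
    obtain ⟨k, b₀, hb₀⟩ := exists_basis_sum_fin hv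
    have hk : k = 1 := by
      have := finrank_eq_card_basis b₀
      simp at this
      omega
    subst hk
    let b : Basis (Fin 3) K (Fin 3 → K) := b₀.reindex finSumFinEquiv
    have hb0 : b 0 = v := by
      change b ((finSumFinEquiv : Fin 2 ⊕ Fin 1 ≃ Fin 3) (Sum.inl 0)) = v
      simp [b, hb₀]
    have hb1 : b 1 = f v := by
      change b ((finSumFinEquiv : Fin 2 ⊕ Fin 1 ≃ Fin 3) (Sum.inl 1)) = f v
      simp [b, hb₀]
    refine (linCombIdem_algEquiv (LinearMap.toMatrixAlgEquiv b)).1 ?_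
    set M := LinearMap.toMatrixAlgEquiv b f with hM
    have hM0 : ∀ i, M i 0 = if i = 1 then 1 else 0 := by
      intro i
      have h1 : f (b 0) = b 1 := by rw [hb0, hb1]
      rw [hM, LinearMap.toMatrixAlgEquiv_apply, h1, b.repr_self, Finsupp.single_apply]
      simp [eq_comm]
    have hsymm : ∀ x, f (b.equivFun.symm x) = b.equivFun.symm (M *ᵥ x) := by
      intro x
      rw [LinearEquiv.eq_symm_apply]
      have := LinearMap.toMatrix_mulVec_repr b b f (b.equivFun.symm x)
      rw [← b.equivFun_apply, LinearEquiv.apply_symm_apply] at this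
      exact this.symm
    have hcycM : ∀ y : Fin 3 → K, ¬ LinearIndependent K ![y, M *ᵥ y, M *ᵥ (M *ᵥ y)] := by
      intro y hy
      apply hcyc (b.equivFun.symm y)
      rw [hsymm, hsymm]
      have h1 := hy.map' b.equivFun.symm.toLinearMap b.equivFun.symm.ker
      have h2 : ![b.equivFun.symm y, b.equivFun.symm (M *ᵥ y), b.equivFun.symm (M *ᵥ (M *ᵥ y))] =
          b.equivFun.symm.toLinearMap ∘ ![y, M *ᵥ y, M *ᵥ (M *ᵥ y)] := by
        ext i : 1
        fin_cases i <;> rfl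
      rw [h2]
      exact h1
    -- Otherwise the first basis vector would be cyclic.
    have hM21 : M 2 1 = 0 := by
      by_contra hne
      refine hcycM ![1, 0, 0] ?_
      refine (linearIndependent_rows_iff_isUnit (A := of ![![1, 0, 0],
        M *ᵥ ![1, 0, 0], M *ᵥ (M *ᵥ ![1, 0, 0])])).2 ?_
      rw [isUnit_iff_isUnit_det, isUnit_iff_ne_zero, det_fin_three]
      simpa [-mulVec_mulVec, mulVec, dotProduct, Fin.sum_univ_three, hM0] using hne
    have hMeq : M = !![0, M 0 1, M 0 2; 1, M 1 1, M 1 2; 0, 0, M 2 2] := by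
      ext i j
      fin_cases i <;> fin_cases j <;> simp [hM0, hM21]
    rw [hMeq] at hcycM ⊢
    obtain ⟨x, y, hxy⟩ := exists_mul_sub_eq_zero_of_no_cyclic fun m₁ m₂ => hcycM ![m₁, m₂, 1]
    exact linCombIdem_two_of_mul_sub_eq_zero hxy

end SmallSizes

/-! ### Assembling the values of the length -/

theorem LinCombIdem.length_eq {K : Type*} [Field K] {n l : ℕ}
    (h : ∀ A : Matrix (Fin n) (Fin n) K, LinCombIdem K (l + 1) A)
    (h' : ∃ A : Matrix (Fin n) (Fin n) K, ¬ LinCombIdem K l A) :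
    IdempotentLengthEq n K (l + 1) := by
  refine ⟨h, fun m hm => ?_⟩
  by_contra! hlt
  obtain ⟨A, hA⟩ := h'
  exact hA (LinCombIdem.mono (hm A) (Nat.le_of_lt_succ hlt))

theorem linCombIdem_three_matrix {K : Type*} [Field K] {n : ℕ} (A : Matrix (Fin n) (Fin n) K) :
    LinCombIdem K 3 A :=
  (linCombIdem_algEquiv Matrix.toLinAlgEquiv').1 (linCombIdem_three _)

theorem idempotentLengthEq_one (K : Type*) [Field K] : IdempotentLengthEq 1 K 1 := by
  refine LinCombIdem.length_eq (fun A => ?_) ⟨1, ?_⟩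
  · have : A = algebraMap K _ (A 0 0) := by
      ext i j
      fin_cases i
      fin_cases j
      simp [Matrix.algebraMap_matrix_apply]
    rw [this]
    exact linCombIdem_one_algebraMap _
  · rintro ⟨c, P, -, h⟩
    simp at h

theorem exists_not_linCombIdem_two {K : Type*} [Field K] {n : ℕ} (hn : 1 ≤ n) (h1 : n ≠ 1)
    (h2 : ¬ (n = 2 ∧ 2 < ENat.card K)) (h3 : ¬ (n = 3 ∧ EveryCubicHasRoot K)) :
    ∃ A : Matrix (Fin n) (Fin n) K, ¬ LinCombIdem K 2 A := by
  rcases eq_or_ne n 2 with rfl | hn2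
  · exact exists_not_linCombIdem_two_of_card_le_two fun h => h2 ⟨rfl, h⟩
  · by_cases hK : EveryCubicHasRoot K
    · have := hK.infinite
      have hn3 : n ≠ 3 := fun h => h3 ⟨h, hK⟩
      exact exists_not_linCombIdem_two_of_infinite (by omega)
    · exact exists_not_linCombIdem_two_of_not_everyCubicHasRoot (by omega) hK

theorem theorem1 (K : Type*) [Field K] (n : ℕ) (hn : 1 ≤ n) :
    (∀ A : Matrix (Fin n) (Fin n) K, IsLinCombIdempotents 3 A) ∧
    (n = 1 → IdempotentLengthEq n K 1) ∧
    (n = 2 ∧ 2 < ENat.card K → IdempotentLengthEq n K 2) ∧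
    (n = 3 ∧ EveryCubicHasRoot K → IdempotentLengthEq n K 2) ∧
    (¬ n = 1 ∧ ¬ (n = 2 ∧ 2 < ENat.card K) ∧ ¬ (n = 3 ∧ EveryCubicHasRoot K) →
      IdempotentLengthEq n K 3) := by
  refine ⟨linCombIdem_three_matrix, ?_, ?_, ?_, ?_⟩
  · rintro rfl
    exact idempotentLengthEq_one K
  · rintro ⟨rfl, hK⟩
    exact LinCombIdem.length_eq (linCombIdem_two_fin_two (exists_ne_ne_of_two_lt_card hK))
      (exists_not_linCombIdem_one le_rfl)
  · rintro ⟨rfl, hK⟩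
    exact LinCombIdem.length_eq (linCombIdem_two_fin_three hK)
      (exists_not_linCombIdem_one (by norm_num))
  · rintro ⟨h1, h2, h3⟩
    exact LinCombIdem.length_eq linCombIdem_three_matrix (exists_not_linCombIdem_two hn h1 h2 h3)
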